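/- Let $U\subset\mathbb{R}^n$ be open and let $\lambda^1,\dots,\lambda^n\in C^\infty(U)$ satisfy $\lambda^j(u)\ne\lambda^k(u)$ for all $u\in U$ and $j\ne k$ (the system $u^k_t=\lambda^k(u)u^k_x$, $k=1,\dots,n$, is strictly hyperbolic). Write $\partial_k=\partial/\partial u^k$, $\lambda^i_k=\partial_k\lambda^i$, $\lambda^i_{ij}=\partial_i\partial_j\lambda^i$, and for $j\ne i$ $$a_{ij}=\frac{\lambda^i_j}{\lambda^j-\lambda^i},\qquad b_{ij}=\frac{\lambda^i_{ij}}{\lambda^i_j}+\frac{\lambda^i_i}{\lambda^j-\lambda^i}=\frac{\partial_i a_{ij}}{a_{ij}}-a_{ji},$$ the latter where $\lambda^i_j\neq0$. On the part of $\mathbb{R}^{2n+2}$, with coordinates $(x,t,u,u_x)$, that lies over $U$, the $i$-th Monge distribution is the rank-$n$ distribution cut out by $$dx+\lambda^i dt=0,\quad du^i=0,\quad du^j+(\lambda^i-\lambda^j)u^j_x\,dt=0\ (j\ne i),\quad du^i_x-\Big(\sum_k u^k_x\lambda^i_k\Big)u^i_x\,dt=0.$$ A Riemann invariant near a point $q_0=(x_0,t_0,u_0,u_{x,0})$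 is a smooth function $F(x,t,u,u_x)$, defined near $q_0$, whose differential vanishes on this distribution; it has order $0$ if it does not depend on $u_x$ near $q_0$, and order $1$ otherwise. One of them is $u^i$; a Riemann invariant $F$ is called extra if $du^i$ and $dF$ are linearly independent at $q_0$. Let $i\in\{1,\dots,n\}$ and $u_0\in U$. Then for every $q_0$ over $u_0$: a) Near $q_0$ the $i$-th Monge distribution admits an extra Riemann invariant of order $0$ if and only if $\lambda^i_k=0$ for all $k\ne i$ in a neighbourhood of $u_0$. b) Assume that either $\lambda^i_j(u_0)\ne0$ for some $j\neq i$, or $\lambda^i_k=0$ for all $k\ne i$ in a neighbourhood of $u_0$ (this holds for all $u_0$ in a dense open subset of $U$). Then near $q_0$ the $i$-th Monge distribution admits an extra Riemann invariant of order $1$ and no extra one of order $0$ (so that $u^i$ is the only one of order $0$ up to functional dependence) if and only if, in a neighbourhood of $u_0$, - $\partial_j a_{ik}=\partial_k a_{ij}$ for all $j,k$ with $i,j,k$ pairwise distinct; - there is a $j\ne i$ with $\lambda^i_j\ne0$ and $\partial_jb_{ij}+a_{ij}b_{ij}=0$; and - for this $j$, and at every point for every $k\ne i$ with $\lambda^i_k\ne0$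 at that point, $b_{ik}=b_{ij}$ and $\partial_kb_{ik}+a_{ik}b_{ik}=0$. In both a) and b) the extra Riemann invariant is then unique up to functional dependence: if $F$ and $G$ are two of them (of order $0$ in a), of order $1$ in b)), then $du^i,dF,dG$ are linearly dependent near $q_0$. -/

import Mathlib

open Filter Topology
open scoped ContDiff

namespace Hydro

/-- The space `ℝ^{2n+2}` with coordinates `(x, t, u, u_x)`, where `u = (u^1, …, u^n)` and
`u_x = (u^1_x, …, u^n_x)`. Tangent vectors are also written as elements of this space. -/
abbrev Jet (n : ℕ) : Type := ℝ × ℝ × (Fin n → ℝ) × (Fin n → ℝ)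

/-- The coordinate (or tangent component) `x`. -/
abbrev Jet.x {n : ℕ} (q : Jet n) : ℝ := q.1
/-- The coordinate (or tangent component) `t`. -/
abbrev Jet.t {n : ℕ} (q : Jet n) : ℝ := q.2.1
/-- The coordinates (or tangent components) `u`. -/
abbrev Jet.u {n : ℕ} (q : Jet n) : Fin n → ℝ := q.2.2.1
/-- The coordinates (or tangent components) `u_x`. -/
abbrev Jet.ux {n : ℕ} (q : Jet n) : Fin n → ℝ := q.2.2.2

/-- The partial derivative `∂_k f = ∂f/∂u^k`. -/
noncomputable def pd {n : ℕ} (k : Fin n) (f : (Fin n → ℝ) → ℝ) (u : Fin n → ℝ) : ℝ :=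
  fderiv ℝ f u (Pi.single k 1)

/-- `a_{ij} = ∂_j λ^i / (λ^j - λ^i)`. -/
noncomputable def aCoef {n : ℕ} (lam : Fin n → (Fin n → ℝ) → ℝ) (i j : Fin n)
    (u : Fin n → ℝ) : ℝ :=
  pd j (lam i) u / (lam j u - lam i u)

/-- `b_{ij} = λ^i_{ij} / λ^i_j + λ^i_i / (λ^j - λ^i)`; used only where `λ^i_j ≠ 0`. -/
noncomputable def bCoef {n : ℕ} (lam : Fin n → (Fin n → ℝ) → ℝ) (i j : Fin n)
    (u : Fin n → ℝ) : ℝ :=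
  pd i (pd j (lam i)) u / pd j (lam i) u + pd i (lam i) u / (lam j u - lam i u)

/-- The total derivative `D_x f = ∑_k u^k_x ∂_k f` of a function `f` of `u`. -/
noncomputable def totalDx {n : ℕ} (f : (Fin n → ℝ) → ℝ) (q : Jet n) : ℝ :=
  ∑ k, q.ux k * pd k f q.u

/-- The `i`-th Monge characteristic distribution of the system `u^k_t = λ^k(u) u^k_x`, at `q`:
the tangent vectors on which the forms `dx + λ^i dt`, `du^i`,
`du^j + (λ^i - λ^j) u^j_x dt` (`j ≠ i`) and `du^i_x - D_x(λ^i) u^i_x dt` vanish. -/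
noncomputable def monge {n : ℕ} (lam : Fin n → (Fin n → ℝ) → ℝ) (i : Fin n) (q : Jet n) :
    Submodule ℝ (Jet n) where
  carrier := {v | v.x + lam i q.u * v.t = 0 ∧ v.u i = 0 ∧
    (∀ j, j ≠ i → v.u j + (lam i q.u - lam j q.u) * q.ux j * v.t = 0) ∧
    v.ux i - totalDx (lam i) q * q.ux i * v.t = 0}
  zero_mem' := by simp [Jet.x, Jet.t, Jet.u, Jet.ux]
  add_mem' := by
    rintro v w ⟨h1, h2, h3, h4⟩ ⟨k1, k2, k3, k4⟩
    simp only [Jet.x, Jet.t, Jet.u, Jet.ux] at *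
    refine ⟨?_, ?_, fun j hj => ?_, ?_⟩ <;>
      simp only [Prod.fst_add, Prod.snd_add, Pi.add_apply]
    · linear_combination h1 + k1
    · linear_combination h2 + k2
    · linear_combination h3 j hj + k3 j hj
    · linear_combination h4 + k4
  smul_mem' := by
    rintro c v ⟨h1, h2, h3, h4⟩
    simp only [Jet.x, Jet.t, Jet.u, Jet.ux] at *
    refine ⟨?_, ?_, fun j hj => ?_, ?_⟩ <;>
      simp only [Prod.smul_fst, Prod.smul_snd, Pi.smul_apply,
        smul_eq_mul]
    · linear_combination c * h1
    · linear_combination c * h2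
    · linear_combination c * h3 j hj
    · linear_combination c * h4

/-- `F` is, near `q₀`, a Riemann invariant of the `i`-th Monge distribution: a smooth first
integral, i.e. `dF` vanishes on the distribution in a neighbourhood of `q₀`. -/
def IsRiemannInvariantAt {n : ℕ} (lam : Fin n → (Fin n → ℝ) → ℝ) (i : Fin n) (q₀ : Jet n)
    (F : Jet n → ℝ) : Prop :=
  ∃ V : Set (Jet n), IsOpen V ∧ q₀ ∈ V ∧ ContDiffOn ℝ ∞ F V ∧
    ∀ q ∈ V, ∀ v ∈ monge lam i q, fderiv ℝ F q v = 0

/-- `F` is of order 0 near `q₀`: it does not depend on the derivatives `u_x` there. -/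
def IsOrderZeroAt {n : ℕ} (q₀ : Jet n) (F : Jet n → ℝ) : Prop :=
  ∀ᶠ q in 𝓝 q₀, ∀ w : Fin n → ℝ, fderiv ℝ F q (0, 0, 0, w) = 0

/-- `F`, a function of `(x, t, u, u_x)`, is of order 1 near `q₀`: it is not of order 0 there. -/
def IsOrderOneAt {n : ℕ} (q₀ : Jet n) (F : Jet n → ℝ) : Prop :=
  ¬ IsOrderZeroAt q₀ F

/-- `F` is, near `q₀`, an extra Riemann invariant of the `i`-th Monge distribution, of the order
given by `ord`: a Riemann invariant functionally independent of the obvious one, `u^i`. -/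
def IsExtraRiemannInvariantAt {n : ℕ} (ord : Jet n → (Jet n → ℝ) → Prop)
    (lam : Fin n → (Fin n → ℝ) → ℝ) (i : Fin n) (q₀ : Jet n) (F : Jet n → ℝ) : Prop :=
  IsRiemannInvariantAt lam i q₀ F ∧ ord q₀ F ∧
    LinearIndependent ℝ ![fderiv ℝ (fun q : Jet n => q.u i) q₀, fderiv ℝ F q₀]

/-- Near `q₀` there is (at least) one extra Riemann invariant of the given order. -/
def AdmitsExtra {n : ℕ} (ord : Jet n → (Jet n → ℝ) → Prop)
    (lam : Fin n → (Fin n → ℝ) → ℝ) (i : Fin n) (q₀ : Jet n) : Prop :=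
  ∃ F, IsExtraRiemannInvariantAt ord lam i q₀ F

/-- Near `q₀` there is exactly one extra Riemann invariant of the given order, up to functional
dependence: for any other one, `G`, the functions `u^i, F, G` are functionally dependent. -/
def AdmitsExactlyOneExtra {n : ℕ} (ord : Jet n → (Jet n → ℝ) → Prop)
    (lam : Fin n → (Fin n → ℝ) → ℝ) (i : Fin n) (q₀ : Jet n) : Prop :=
  ∃ F, IsExtraRiemannInvariantAt ord lam i q₀ F ∧
    ∀ G, IsExtraRiemannInvariantAt ord lam i q₀ G →
      ∀ᶠ q in 𝓝 q₀, ¬ LinearIndependent ℝ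
        ![fderiv ℝ (fun q : Jet n => q.u i) q, fderiv ℝ F q, fderiv ℝ G q]

/-- Near `u₀`, `λ^i_k = 0` for all `k ≠ i`. -/
def TransverselyConstantAt {n : ℕ} (lam : Fin n → (Fin n → ℝ) → ℝ) (i : Fin n)
    (u₀ : Fin n → ℝ) : Prop :=
  ∀ᶠ u in 𝓝 u₀, ∀ k, k ≠ i → pd k (lam i) u = 0

/-- The alternative "`λ^i_j ≠ 0` for some `j ≠ i`, or `λ^i_k = 0` for all `k ≠ i`" at `u₀`, with
non-vanishing understood at `u₀` and vanishing understood identically near `u₀`. -/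
def IsRegularPoint {n : ℕ} (lam : Fin n → (Fin n → ℝ) → ℝ) (i : Fin n)
    (u₀ : Fin n → ℝ) : Prop :=
  (∃ j, j ≠ i ∧ pd j (lam i) u₀ ≠ 0) ∨ TransverselyConstantAt lam i u₀

/-- Near `u₀`, `∂_j a_{ik} = ∂_k a_{ij}` for all pairwise distinct `i, j, k` (`i` fixed). -/
def IsSemihamiltonianAt {n : ℕ} (lam : Fin n → (Fin n → ℝ) → ℝ) (i : Fin n)
    (u₀ : Fin n → ℝ) : Prop :=
  ∀ᶠ u in 𝓝 u₀, ∀ j k, j ≠ i → k ≠ i → k ≠ j →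
    pd j (aCoef lam i k) u = pd k (aCoef lam i j) u

/-- The three conditions for a Riemann invariant of order 1, near `u₀`. -/
def OrderOneConditionsAt {n : ℕ} (lam : Fin n → (Fin n → ℝ) → ℝ) (i : Fin n)
    (u₀ : Fin n → ℝ) : Prop :=
  IsSemihamiltonianAt lam i u₀ ∧
  ∃ j, j ≠ i ∧
    (∀ᶠ u in 𝓝 u₀, pd j (lam i) u ≠ 0 ∧
      pd j (bCoef lam i j) u + aCoef lam i j u * bCoef lam i j u = 0) ∧
    (∀ᶠ u in 𝓝 u₀, ∀ k, k ≠ i → pd k (lam i) u ≠ 0 →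
      bCoef lam i k u = bCoef lam i j u ∧
      pd k (bCoef lam i k) u + aCoef lam i k u * bCoef lam i k u = 0)

end Hydro

/-! Write `p` for `u^i_x`. The `i`-th Monge distribution is spanned by the `∂/∂u^j_x`, `j ≠ i`, and
`mongeField`. A first integral `F` is also killed by their Lie brackets, so everything rests on
completing the distribution under brackets. Bracketing `∂/∂u^j_x` with `mongeField` gives `∂_{u^j} +
a_{ij} p ∂_p` (`fderiv_dirU_eq`), after which `mongeField` reduces to `∂_t - λ^i ∂_x + λ^i_i p² ∂_p`
(`fderiv_dirT_eq`). Hence `dF` is determined by `F_x`, `F_{u^i}` and `F_p` (`fderiv_apply_eq`).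

Further brackets give `λ^i_j F_x = (λ^i_{ij} + a_{ij} λ^i_i) p² F_p`, then `(∂_j a_{ik} - ∂_k
a_{ij}) p F_p = 0` and, where `λ^i_k ≠ 0`, `(∂_k b_{ik} + a_{ik} b_{ik}) p² F_p = 0`. An extra
invariant of order 0 has `F_p = 0` and `F_x ≠ 0`, which forces every `λ^i_j`, `j ≠ i`, to vanish;
conversely `x + λ^i t` is then an invariant. If `λ^i_j ≠ 0`, then `F_x = b_{ij} p² F_p`, so an extra
invariant has `F_p ≠ 0` and the three conditions follow wherever `p ≠ 0`. They involve `u` alone, so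
they hold near `u₀` even if `p = 0` at `q₀`.

For the converse in b), a potential `φ` of the `a_{ik}` in the variables `u^k`, `k ≠ i`, exists by
the Poincaré lemma with `u^i` as parameter. Since `1/p` straightens `p² ∂_p`, the function `e^φ (1/p
- b (x - x₀) - c (t - t₀))` with `b = b_{ij}` and `c = λ^i b - λ^i_i` is invariant; its reciprocal
`orderOneInvariant` is smooth at `p = 0` as well. Uniqueness holds because in each case the
differentials of all invariants concerned lie in the span of `du^i` and one fixed form. -/

namespace Hydro

/-! ### Poincaré lemma with parameters, and smooth cut-off. -/

section Poincare

variable {E : Type*} [NormedAddCommGroup E] [NormedSpace ℝ E]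

theorem hasDerivAt_oneForm_along {w : E → E →L[ℝ] ℝ} {γ δ : ℝ → E} {γ' δ' : E} {s : ℝ}
    (hw : DifferentiableAt ℝ w (γ s)) (hγ : HasDerivAt γ γ' s) (hδ : HasDerivAt δ δ' s) :
    HasDerivAt (fun s => w (γ s) (δ s)) (fderiv ℝ w (γ s) γ' (δ s) + w (γ s) δ') s :=
  HasDerivAt.clm_apply (c := fun s => w (γ s)) (hw.hasFDerivAt.comp_hasDerivAt s hγ) hδ

variable [FiniteDimensional ℝ E]

theorem hasFDerivAt_integral_of_contDiff {f : E × ℝ → ℝ} (hf : ContDiff ℝ ∞ f) (u : E) :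
    HasFDerivAt (fun u => ∫ s in (0 : ℝ)..1, f (u, s))
      (∫ s in (0 : ℝ)..1, (fderiv ℝ f (u, s)).comp (ContinuousLinearMap.inl ℝ E ℝ)) u := by
  have hf' : Continuous (fderiv ℝ f) := hf.continuous_fderiv (by simp)
  have hcont : Continuous fun z : E × ℝ =>
      (fderiv ℝ f z).comp (ContinuousLinearMap.inl ℝ E ℝ) := by fun_prop
  -- A constant dominates the derivative, by compactness of the closed ball in finite dimension.
  obtain ⟨C, hC⟩ := ((isCompact_closedBall u 1).prod
    (isCompact_Icc (a := (0 : ℝ)) (b := 1))).exists_bound_of_continuousOn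
    hcont.continuousOn
  refine (intervalIntegral.hasFDerivAt_integral_of_dominated_of_fderiv_le
    (F := fun u s => f (u, s))
    (F' := fun u s => (fderiv ℝ f (u, s)).comp (ContinuousLinearMap.inl ℝ E ℝ))
    (bound := fun _ => C) (Metric.ball_mem_nhds u one_pos) ?_ ?_ ?_ ?_ ?_ ?_)
  · refine Eventually.of_forall fun v => Continuous.aestronglyMeasurable ?_
    exact hf.continuous.comp (by fun_prop)
  · exact (hf.continuous.comp (by fun_prop)).intervalIntegrable _ _
  · exact (hcont.comp (by fun_prop : Continuous fun s : ℝ => (u, s))).aestronglyMeasurable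
  · refine Eventually.of_forall fun s hs v hv => ?_
    rw [Set.uIoc_of_le zero_le_one] at hs
    exact hC (v, s) ⟨Metric.ball_subset_closedBall hv, hs.1.le, hs.2⟩
  · exact intervalIntegrable_const
  · refine Eventually.of_forall fun s _ v _ => ?_
    exact ((hf.differentiable (by simp)) (v, s)).hasFDerivAt.comp v
      (hasFDerivAt_prodMk_left v s)

theorem fderiv_integral_of_contDiff {f : E × ℝ → ℝ} (hf : ContDiff ℝ ∞ f) (u v : E) :
    fderiv ℝ (fun u => ∫ s in (0 : ℝ)..1, f (u, s)) u v =
      ∫ s in (0 : ℝ)..1, fderiv ℝ f (u, s) (v, 0) := by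
  have hf' : Continuous (fderiv ℝ f) := hf.continuous_fderiv (by simp)
  rw [(hasFDerivAt_integral_of_contDiff hf u).fderiv, ContinuousLinearMap.intervalIntegral_apply]
  · simp
  · exact Continuous.intervalIntegrable (by fun_prop) _ _

/-- Each directional derivative is again the integral of a smooth integrand, so the induction on the
order closes once `f` is generalized. -/
theorem contDiff_integral_of_contDiff {f : E × ℝ → ℝ} (hf : ContDiff ℝ ∞ f) :
    ContDiff ℝ ∞ fun u => ∫ s in (0 : ℝ)..1, f (u, s) := by
  rw [contDiff_infty]
  intro m
  induction m generalizing f with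
  | zero =>
    exact contDiff_zero.2 (continuous_iff_continuousAt.2 fun u =>
      (hasFDerivAt_integral_of_contDiff hf u).continuousAt)
  | succ m ih =>
    push_cast
    rw [contDiff_succ_iff_fderiv_apply]
    refine ⟨fun u => (hasFDerivAt_integral_of_contDiff hf u).differentiableAt, by simp,
      fun v => ?_⟩
    simp only [fderiv_integral_of_contDiff hf]
    exact ih (f := fun z => fderiv ℝ f z (v, 0))
      ((hf.fderiv_right (m := ∞) (by simp)).clm_apply contDiff_const)

/-- The Poincaré lemma with parameters: a 1-form that is closed along the range of `P` is exact
along the fixed vectors of `P`. -/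
theorem exists_fderiv_eq_of_closed_along (P : E →L[ℝ] E) {w : E → E →L[ℝ] ℝ}
    (hw : ContDiff ℝ ∞ w) (x₀ : E)
    (hclosed : ∀ᶠ x in 𝓝 x₀, ∀ v v', fderiv ℝ w x (P v) (P v') = fderiv ℝ w x (P v') (P v)) :
    ∃ g : E → ℝ, ContDiff ℝ ∞ g ∧ ∀ᶠ x in 𝓝 x₀, ∀ v, P v = v → fderiv ℝ g x v = w x v := by
  -- The homotopy contracts only the directions in the range of `P` and ends at `x` for `s = 1`; `f`
  -- evaluates `w` on its velocity.
  let c : E × ℝ → E := fun z => z.1 + (z.2 - 1) • P (z.1 - x₀)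
  let f : E × ℝ → ℝ := fun z => w (c z) (P (z.1 - x₀))
  have hc : ContDiff ℝ ∞ c := by fun_prop
  have hf : ContDiff ℝ ∞ f := (hw.comp hc).clm_apply (by fun_prop)
  refine ⟨_, contDiff_integral_of_contDiff hf, ?_⟩
  obtain ⟨r, hr, hball⟩ := Metric.eventually_nhds_iff.1 hclosed
  -- The path satisfies `‖c (x, s) - x₀‖ ≤ (1 + ‖P‖) ‖x - x₀‖` for `s` in `[0, 1]`, so it stays in
  -- the ball where `w` is closed.
  have hr' : 0 < r / (1 + ‖P‖) := by positivity
  filter_upwards [Metric.ball_mem_nhds x₀ hr'] with x hx v hv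
  have hmem : ∀ s ∈ Set.Icc (0 : ℝ) 1, dist (c (x, s)) x₀ < r := by
    intro s hs
    rw [Metric.mem_ball, dist_eq_norm, lt_div_iff₀ (by positivity)] at hx
    rw [dist_eq_norm]
    have h1 : c (x, s) - x₀ = (x - x₀) + (s - 1) • P (x - x₀) := by simp only [c]; abel
    have h2 : ‖(s - 1) • P (x - x₀)‖ ≤ ‖P‖ * ‖x - x₀‖ := by
      rw [norm_smul]
      have : ‖s - 1‖ ≤ 1 := by rw [Real.norm_eq_abs, abs_le]; constructor <;> linarith [hs.1, hs.2]
      calc _ ≤ 1 * (‖P‖ * ‖x - x₀‖) := by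
            gcongr
            exact P.le_opNorm _
        _ = _ := one_mul _
    rw [h1]
    refine (norm_add_le _ _).trans_lt ?_
    linarith
  rw [fderiv_integral_of_contDiff hf]
  -- By closedness the integrand is the `s`-derivative of `s * w (c (x, s)) v`, which is `0` at `s =
  -- 0` and `w x v` at `s = 1`.
  have hderiv : ∀ s ∈ Set.uIcc (0 : ℝ) 1, HasDerivAt (fun s => s * w (c (x, s)) v)
      (fderiv ℝ f (x, s) (v, 0)) s := by
    intro s hs
    rw [Set.uIcc_of_le zero_le_one] at hs
    have hwd : ∀ y, DifferentiableAt ℝ w y := fun y => hw.differentiable (by simp) y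
    have hcs : HasDerivAt (fun s => c (x, s)) (P (x - x₀)) s := by
      simpa [c] using (((hasDerivAt_id s).sub_const 1).smul_const (P (x - x₀))).const_add x
    have h1 : HasDerivAt (fun s => w (c (x, s)) v)
        (fderiv ℝ w (c (x, s)) (P (x - x₀)) v) s := by
      simpa using hasDerivAt_oneForm_along (hwd _) hcs (hasDerivAt_const s v)
    have h2 : fderiv ℝ f (x, s) (v, 0) =
        s * fderiv ℝ w (c (x, s)) (P (x - x₀)) v + w (c (x, s)) v := by
      have hline : HasDerivAt (fun τ : ℝ => x + τ • v) v 0 := by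
        simpa using ((hasDerivAt_id (0 : ℝ)).smul_const v).const_add x
      have hP : HasDerivAt (fun τ : ℝ => P (x + τ • v - x₀)) v 0 := by
        have := P.hasFDerivAt.comp_hasDerivAt (0 : ℝ) (hline.sub_const x₀)
        rw [hv] at this
        exact this
      have hcl : HasDerivAt (fun τ : ℝ => c (x + τ • v, s)) (s • v) 0 := by
        have := hline.add (hP.const_smul (s - 1))
        have e : v + (s - 1) • v = s • v := by rw [sub_smul, one_smul]; abel
        rw [e] at this
        exact this
      have h3 := hasDerivAt_oneForm_along (hwd _) hcl hP
      have h4 : HasDerivAt (fun τ : ℝ => f (x + τ • v, s)) (fderiv ℝ f (x, s) (v, 0)) 0 := by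
        have hfd : HasFDerivAt f (fderiv ℝ f (x, s)) (x + (0 : ℝ) • v, s) := by
          rw [zero_smul, add_zero]
          exact (hf.differentiable (by simp) (x, s)).hasFDerivAt
        exact hfd.comp_hasDerivAt (f := fun τ : ℝ => (x + τ • v, s)) (0 : ℝ)
          (hline.prodMk (hasDerivAt_const _ s))
      rw [h4.unique h3]
      have hsym := hball (hmem s hs) v (x - x₀)
      rw [hv] at hsym
      simp [-map_sub, hsym]
    rw [h2, add_comm, ← one_mul (w (c (x, s)) v)]
    exact (hasDerivAt_id' s).mul h1
  have hcont : Continuous (fun s : ℝ => fderiv ℝ f (x, s) (v, 0)) := by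
    have hf' : Continuous (fderiv ℝ f) := hf.continuous_fderiv (by simp)
    fun_prop
  rw [intervalIntegral.integral_eq_sub_of_hasDerivAt hderiv (hcont.intervalIntegrable _ _)]
  simp [c]

/-- Multiplying by a bump function replaces local data by globally smooth data with the same germ,
so the integrals above need no domain conditions. -/
theorem exists_contDiff_eventuallyEq {U : Set E} (hU : IsOpen U) {a : E → ℝ}
    (ha : ContDiffOn ℝ ∞ a U) {x₀ : E} (hx : x₀ ∈ U) :
    ∃ g : E → ℝ, ContDiff ℝ ∞ g ∧ g =ᶠ[𝓝 x₀] a := by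
  obtain ⟨r, hr, hball⟩ := Metric.isOpen_iff.1 hU x₀ hx
  let χ : ContDiffBump x₀ := ⟨r / 4, r / 2, by positivity, by linarith⟩
  refine ⟨fun x => χ x * a x, ?_, ?_⟩
  · rw [contDiff_iff_contDiffAt]
    intro x
    by_cases hxr : x ∈ Metric.ball x₀ r
    · exact χ.contDiff.contDiffAt.mul (ha.contDiffAt (hU.mem_nhds (hball hxr)))
    · have hnot : x ∉ tsupport χ := by
        rw [χ.tsupport_eq]
        intro h
        exact hxr (Metric.closedBall_subset_ball (by change r / 2 < r; linarith) h)
      refine (contDiffAt_const (c := (0 : ℝ))).congr_of_eventuallyEq ?_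
      filter_upwards [notMem_tsupport_iff_eventuallyEq.1 hnot] with y hy
      simp [hy]
  · filter_upwards [χ.eventuallyEq_one] with y hy
    simp [hy]

end Poincare

/-! ### Calculus of partial derivatives, and potentials. -/

section PartialDerivatives

variable {n : ℕ} {f g : (Fin n → ℝ) → ℝ} {u : Fin n → ℝ} {U : Set (Fin n → ℝ)}

theorem fderiv_apply_eq_sum_pd (f : (Fin n → ℝ) → ℝ) (u v : Fin n → ℝ) :
    fderiv ℝ f u v = ∑ k, v k * pd k f u := by
  conv_lhs => rw [pi_eq_sum_univ' v]
  simp [pd, map_sum, Pi.single]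

theorem contDiffOn_pd (hU : IsOpen U) (hf : ContDiffOn ℝ ∞ f U) (k : Fin n) :
    ContDiffOn ℝ ∞ (pd k f) U :=
  (hf.fderiv_of_isOpen hU (m := ∞) (by simp)).clm_apply contDiffOn_const

theorem differentiableAt_of_contDiffOn (hU : IsOpen U) (hf : ContDiffOn ℝ ∞ f U) (hu : u ∈ U) :
    DifferentiableAt ℝ f u :=
  (hf.differentiableOn (by simp)).differentiableAt (hU.mem_nhds hu)

theorem pd_comm (hU : IsOpen U) (hf : ContDiffOn ℝ ∞ f U) (hu : u ∈ U) (j k : Fin n) :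
    pd j (pd k f) u = pd k (pd j f) u := by
  have hd : DifferentiableAt ℝ (fderiv ℝ f) u :=
    ((hf.fderiv_of_isOpen hU (m := ∞) (by simp)).differentiableOn (by simp)).differentiableAt
      (hU.mem_nhds hu)
  have h : ∀ j k : Fin n, pd j (pd k f) u = fderiv ℝ (fderiv ℝ f) u (Pi.single j 1)
      (Pi.single k 1) := fun j k => by
    unfold pd
    rw [fderiv_clm_apply hd (differentiableAt_const _)]
    simp
  rw [h, h]
  exact ((hf.contDiffAt (hU.mem_nhds hu)).isSymmSndFDerivAt (by simpa using WithTop.coe_le_coe.2 (le_top : (2 : ℕ∞) ≤ ⊤))) _ _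

theorem pd_congr (h : f =ᶠ[𝓝 u] g) (k : Fin n) : pd k f u = pd k g u := by
  rw [pd, pd, h.fderiv_eq]

theorem pd_eq_zero_of_eventually_zero (h : ∀ᶠ v in 𝓝 u, f v = 0) (k : Fin n) : pd k f u = 0 := by
  have h' : f =ᶠ[𝓝 u] fun _ => 0 := h
  rw [pd_congr h']
  simp [pd]

theorem pd_add (hf : DifferentiableAt ℝ f u) (hg : DifferentiableAt ℝ g u) (k : Fin n) :
    pd k (fun v => f v + g v) u = pd k f u + pd k g u := by
  simp only [pd]
  rw [fderiv_fun_add hf hg]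
  simp

theorem pd_sub (hf : DifferentiableAt ℝ f u) (hg : DifferentiableAt ℝ g u) (k : Fin n) :
    pd k (fun v => f v - g v) u = pd k f u - pd k g u := by
  simp only [pd]
  rw [fderiv_fun_sub hf hg]
  simp

theorem pd_mul (hf : DifferentiableAt ℝ f u) (hg : DifferentiableAt ℝ g u) (k : Fin n) :
    pd k (fun v => f v * g v) u = pd k f u * g u + f u * pd k g u := by
  simp only [pd]
  rw [fderiv_fun_mul hf hg]
  simp
  ring

theorem differentiableAt_div (hf : DifferentiableAt ℝ f u) (hg : DifferentiableAt ℝ g u)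
    (h0 : g u ≠ 0) : DifferentiableAt ℝ (fun v => f v / g v) u := by
  simp only [div_eq_mul_inv]
  exact hf.mul (hg.inv h0)

theorem pd_div (hf : DifferentiableAt ℝ f u) (hg : DifferentiableAt ℝ g u) (h0 : g u ≠ 0)
    (k : Fin n) :
    pd k (fun v => f v / g v) u = pd k f u / g u - f u * pd k g u / g u ^ 2 := by
  have h := pd_mul (differentiableAt_div hf hg h0) hg k
  have hfg : (fun v => f v / g v * g v) =ᶠ[𝓝 u] f := by
    filter_upwards [hg.continuousAt.eventually_ne h0] with v hv
    exact div_mul_cancel₀ _ hv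
  rw [pd_congr hfg] at h
  rw [h]
  field_simp
  ring

theorem exists_potential (hU : IsOpen U) {a : Fin n → (Fin n → ℝ) → ℝ} {i : Fin n}
    (ha : ∀ k, k ≠ i → ContDiffOn ℝ ∞ (a k) U) {u₀ : Fin n → ℝ} (hu₀ : u₀ ∈ U)
    (hclosed : ∀ᶠ u in 𝓝 u₀, ∀ j k, j ≠ i → k ≠ i → k ≠ j → pd j (a k) u = pd k (a j) u) :
    ∃ φ : (Fin n → ℝ) → ℝ, ContDiff ℝ ∞ φ ∧ ∀ᶠ u in 𝓝 u₀, ∀ k, k ≠ i → pd k φ u = a k u := by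
  have hex : ∀ k, ∃ c : (Fin n → ℝ) → ℝ, ContDiff ℝ ∞ c ∧ (k ≠ i → c =ᶠ[𝓝 u₀] a k) := fun k => by
    by_cases hk : k = i
    · exact ⟨fun _ => 0, contDiff_const, fun h => absurd hk h⟩
    · obtain ⟨c, hc, hca⟩ := exists_contDiff_eventuallyEq hU (ha k hk) hu₀
      exact ⟨c, hc, fun _ => hca⟩
  choose c hc hca using hex
  have hca' : ∀ᶠ u in 𝓝 u₀, ∀ k, k ≠ i → c k =ᶠ[𝓝 u] a k := by
    rw [eventually_all]
    intro k
    by_cases hk : k = i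
    · simp [hk]
    · filter_upwards [(hca k hk).eventuallyEq_nhds] with u hu _ using hu
  let w : (Fin n → ℝ) → (Fin n → ℝ) →L[ℝ] ℝ := fun u =>
    ∑ k, c k u • ContinuousLinearMap.proj (R := ℝ) (φ := fun _ : Fin n => ℝ) k
  have hw : ContDiff ℝ ∞ w := ContDiff.sum fun k _ => (hc k).smul contDiff_const
  have hwa : ∀ u v, w u v = ∑ k, c k u * v k := fun u v => by
    simp [w]
  have hfd : ∀ u v v', fderiv ℝ w u v v' = ∑ k, ∑ j, v j * v' k * pd j (c k) u := by
    intro u v v'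
    have h1 : fderiv ℝ w u v v' = fderiv ℝ (fun x => w x v') u v := by
      rw [fderiv_clm_apply (hw.differentiable (by simp) u) (differentiableAt_const _)]
      simp
    rw [h1]
    simp only [hwa]
    rw [fderiv_fun_sum fun k _ => ((hc k).differentiable (by simp) u).mul_const _,
      _root_.sum_apply]
    refine Finset.sum_congr rfl fun k _ => ?_
    rw [fderiv_mul_const ((hc k).differentiable (by simp) u), _root_.smul_apply,
      fderiv_apply_eq_sum_pd, smul_eq_mul, Finset.mul_sum]
    exact Finset.sum_congr rfl fun j _ => by ring
  -- Erasing the `i`-th component makes `u^i` a parameter: only the mixed derivatives with both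
  -- indices different from `i` enter the closedness condition.
  let P : (Fin n → ℝ) →L[ℝ] (Fin n → ℝ) := ContinuousLinearMap.pi fun k =>
    if k = i then 0 else ContinuousLinearMap.proj k
  have hP : ∀ v k, P v k = if k = i then 0 else v k := fun v k => by
    by_cases hk : k = i <;> simp [P, hk]
  obtain ⟨φ, hφ, hφw⟩ := exists_fderiv_eq_of_closed_along P hw u₀ (by
    filter_upwards [hclosed, hca'] with u hu hcu v v'
    rw [hfd, hfd, Finset.sum_comm]
    refine Finset.sum_congr rfl fun j _ => Finset.sum_congr rfl fun k _ => ?_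
    by_cases hj : j = i
    · simp [hP, hj]
    by_cases hk : k = i
    · simp [hP, hk]
    by_cases hkj : k = j
    · rw [hkj]; ring
    rw [pd_congr (hcu k hk), pd_congr (hcu j hj), hu j k hj hk hkj]
    ring)
  refine ⟨φ, hφ, ?_⟩
  filter_upwards [hφw, hca'] with u hu hcu k hk
  have hfix : P (Pi.single k 1) = Pi.single k 1 := by
    ext l
    rw [hP]
    by_cases hl : l = i
    · subst hl; simp [Ne.symm hk]
    · simp [hl]
  rw [pd, hu _ hfix, hwa, Finset.sum_eq_single k, (hcu k hk).eq_of_nhds]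
  · simp
  · intro l _ hl; simp [hl]
  · simp

end PartialDerivatives

/-! ### The coefficients `a_{ij}` and `b_{ij}`. -/

section Coefficients

variable {n : ℕ} {U : Set (Fin n → ℝ)} {lam : Fin n → (Fin n → ℝ) → ℝ} {i j k : Fin n}
  {u : Fin n → ℝ}

theorem contDiffOn_aCoef (hU : IsOpen U) (hsmooth : ∀ k, ContDiffOn ℝ ∞ (lam k) U)
    (hhyp : ∀ u ∈ U, ∀ j k, j ≠ k → lam j u ≠ lam k u) (hj : j ≠ i) :
    ContDiffOn ℝ ∞ (aCoef lam i j) U :=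
  (contDiffOn_pd hU (hsmooth i) j).div ((hsmooth j).sub (hsmooth i))
    fun u hu => sub_ne_zero.2 (hhyp u hu j i hj)

theorem isOpen_pd_ne_zero (hU : IsOpen U) {f : (Fin n → ℝ) → ℝ} (hf : ContDiffOn ℝ ∞ f U) :
    IsOpen {u | u ∈ U ∧ pd j f u ≠ 0} :=
  (contDiffOn_pd hU hf j).continuousOn.isOpen_inter_preimage hU isOpen_ne

theorem contDiffOn_bCoef (hU : IsOpen U) (hsmooth : ∀ k, ContDiffOn ℝ ∞ (lam k) U)
    (hhyp : ∀ u ∈ U, ∀ j k, j ≠ k → lam j u ≠ lam k u) (hj : j ≠ i) :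
    ContDiffOn ℝ ∞ (bCoef lam i j) {u | u ∈ U ∧ pd j (lam i) u ≠ 0} := by
  have hsub : {u | u ∈ U ∧ pd j (lam i) u ≠ 0} ⊆ U := fun u hu => hu.1
  have h1 := contDiffOn_pd hU (hsmooth i) j
  refine (((contDiffOn_pd hU h1 i).mono hsub).div (h1.mono hsub) fun u hu => hu.2).add
    (((contDiffOn_pd hU (hsmooth i) i).mono hsub).div (((hsmooth j).sub (hsmooth i)).mono hsub)
    fun u hu => sub_ne_zero.2 (hhyp u hu.1 j i hj))

/-- In the logarithmic derivative of `a_{ij}`, the term containing `∂_i λ^j` is cancelled by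
`a_{ji}`. -/
theorem bCoef_eq_pd_aCoef (hU : IsOpen U) (hsmooth : ∀ k, ContDiffOn ℝ ∞ (lam k) U)
    (hhyp : ∀ u ∈ U, ∀ j k, j ≠ k → lam j u ≠ lam k u) (hu : u ∈ U) (hj : j ≠ i)
    (h0 : pd j (lam i) u ≠ 0) :
    bCoef lam i j u = pd i (aCoef lam i j) u / aCoef lam i j u - aCoef lam j i u := by
  have hd := fun k => differentiableAt_of_contDiffOn hU (hsmooth k) hu
  have h1 := differentiableAt_of_contDiffOn hU (contDiffOn_pd hU (hsmooth i) j) hu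
  have hne : lam j u - lam i u ≠ 0 := sub_ne_zero.2 (hhyp u hu j i hj)
  have hne' : lam i u - lam j u ≠ 0 := sub_ne_zero.2 (hhyp u hu i j hj.symm)
  have := pd_div h1 ((hd j).sub (hd i)) hne i
  change pd i (aCoef lam i j) u = _ at this
  rw [this, show pd i (lam j - lam i) u = _ from pd_sub (hd j) (hd i) i]
  have e : lam i u - lam j u = -(lam j u - lam i u) := by ring
  simp only [bCoef, aCoef, Pi.sub_apply]
  rw [e]
  generalize lam j u - lam i u = Δ at *
  field_simp
  ring

/-- The left side is the coefficient that the brackets produce; unlike `b_{ij}` it makes sense where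
`λ^i_j = 0`. -/
theorem pd_mul_bCoef (hne : lam j u ≠ lam i u) (h0 : pd j (lam i) u ≠ 0) :
    pd i (pd j (lam i)) u + aCoef lam i j u * pd i (lam i) u = pd j (lam i) u * bCoef lam i j u := by
  have hne : lam j u - lam i u ≠ 0 := sub_ne_zero.2 hne
  simp only [bCoef, aCoef]
  field_simp

/-- Where `λ^i_k` vanishes identically, `b_{ij}` does not depend on `u^k`. -/
theorem pd_bCoef_eq_zero (hU : IsOpen U) (hsmooth : ∀ k, ContDiffOn ℝ ∞ (lam k) U)
    (hhyp : ∀ u ∈ U, ∀ j k, j ≠ k → lam j u ≠ lam k u) (hu : u ∈ U) (hj : j ≠ i)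
    (h0 : pd j (lam i) u ≠ 0) (hk : ∀ᶠ v in 𝓝 u, pd k (lam i) v = 0)
    (hsym : pd j (aCoef lam i k) u = pd k (aCoef lam i j) u) :
    pd k (bCoef lam i j) u = 0 := by
  have hd := fun k => differentiableAt_of_contDiffOn hU (hsmooth k) hu
  have hs1 := fun l => contDiffOn_pd hU (hsmooth i) l
  have hs2 := fun l m => contDiffOn_pd hU (hs1 l) m
  have hd1 := fun l => differentiableAt_of_contDiffOn hU (hs1 l) hu
  have hne : lam j u - lam i u ≠ 0 := sub_ne_zero.2 (hhyp u hu j i hj)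
  have hcomm : ∀ l, pd k (pd l (lam i)) u = 0 := fun l => by
    rw [pd_comm hU (hsmooth i) hu]
    exact pd_eq_zero_of_eventually_zero hk l
  have hcomm2 : pd k (pd i (pd j (lam i))) u = 0 := by
    rw [pd_comm hU (hs1 j) hu]
    refine pd_eq_zero_of_eventually_zero ?_ i
    filter_upwards [eventually_eventually_nhds.2 hk, hU.mem_nhds hu] with v hv hvU
    rw [pd_comm hU (hsmooth i) hvU]
    exact pd_eq_zero_of_eventually_zero hv j
  have hak : pd j (aCoef lam i k) u = 0 := by
    refine pd_eq_zero_of_eventually_zero ?_ j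
    filter_upwards [hk] with v hv
    simp [aCoef, hv]
  -- As `a_{ik}` vanishes near `u`, symmetry gives `∂_k a_{ij} = 0`. The numerator `λ^i_j` is
  -- nonzero with zero `u^k`-derivative, so the denominator has zero `u^k`-derivative too.
  have hΔ : pd k (lam j - lam i) u = 0 := by
    have h := pd_div (hd1 j) ((hd j).sub (hd i)) hne k
    change pd k (aCoef lam i j) u = _ at h
    rw [← hsym, hak, hcomm j] at h
    simp only [Pi.sub_apply] at h
    have hsq : (lam j u - lam i u) ^ 2 ≠ 0 := pow_ne_zero 2 hne
    have h' : pd j (lam i) u * pd k (lam j - lam i) u / (lam j u - lam i u) ^ 2 = 0 := by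
      linarith [zero_div (lam j u - lam i u)]
    rw [div_eq_zero_iff, or_iff_left hsq] at h'
    exact (mul_eq_zero.1 h').resolve_left h0
  have hd2 := differentiableAt_of_contDiffOn hU (hs2 j i) hu
  have h1 := pd_div hd2 (hd1 j) h0 k
  have h2 := pd_div (hd1 i) ((hd j).sub (hd i)) hne k
  have h3 := pd_add (differentiableAt_div hd2 (hd1 j) h0)
    (differentiableAt_div (hd1 i) ((hd j).sub (hd i)) hne) k
  have h4 : pd k (bCoef lam i j) u = _ := h3
  rw [h4]
  change pd k (fun v => pd i (pd j (lam i)) v / pd j (lam i) v) u +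
    pd k (fun v => pd i (lam i) v / (lam j - lam i) v) u = 0
  rw [h1, h2, hcomm2, hcomm, hcomm, hΔ]
  simp

/-- If `g x ≠ 0`, then `g ≠ 0` near `x`, so `f` vanishes near `x` and `h2` applies. With `f = λ^i_k`
it reduces an identity to the open set `λ^i_k ≠ 0` and the interior of its complement. -/
theorem eq_zero_of_eq_zero_off_interior {X : Type*} [TopologicalSpace X] {N : Set X}
    (hN : IsOpen N) {f g : X → ℝ} (hg : ContinuousOn g N) (h1 : ∀ x ∈ N, f x ≠ 0 → g x = 0)
    (h2 : ∀ x ∈ N, (∀ᶠ y in 𝓝 x, f y = 0) → g x = 0) : ∀ x ∈ N, g x = 0 := by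
  intro x hx
  by_contra hgx
  refine hgx (h2 x hx ?_)
  filter_upwards [(hg.isOpen_inter_preimage hN isOpen_ne).mem_nhds ⟨hx, hgx⟩] with y hy
  by_contra hfy
  exact hy.2 (h1 y hy.1 hfy)

/-- The order-one conditions, extended by continuity to the indices `k` for which `λ^i_k` may
vanish. -/
theorem OrderOneConditionsAt.exists_bCoef (hU : IsOpen U)
    (hsmooth : ∀ k, ContDiffOn ℝ ∞ (lam k) U)
    (hhyp : ∀ u ∈ U, ∀ j k, j ≠ k → lam j u ≠ lam k u) (hu : u ∈ U)
    (h : OrderOneConditionsAt lam i u) :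
    ∃ j, j ≠ i ∧ ∀ᶠ v in 𝓝 u, pd j (lam i) v ≠ 0 ∧ ∀ k, k ≠ i →
      pd k (pd i (lam i)) v + aCoef lam i k v * pd i (lam i) v =
        pd k (lam i) v * bCoef lam i j v ∧
      pd k (bCoef lam i j) v + aCoef lam i k v * bCoef lam i j v = 0 := by
  obtain ⟨hsemi, j, hj, hev1, hev2⟩ := h
  refine ⟨j, hj, ?_⟩
  obtain ⟨N, hNsub, hNo, huN⟩ := eventually_nhds_iff.1
    (hsemi.and (hev1.and (hev2.and (hU.mem_nhds hu))))
  have hNU : N ⊆ U := fun v hv => (hNsub v hv).2.2.2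
  have hNj : N ⊆ {u | u ∈ U ∧ pd j (lam i) u ≠ 0} := fun v hv => ⟨hNU hv, (hNsub v hv).2.1.1⟩
  have hs1 := fun l => contDiffOn_pd hU (hsmooth i) l
  have hcb := (contDiffOn_bCoef hU hsmooth hhyp hj).mono hNj
  have hca := fun k (hk : k ≠ i) => (contDiffOn_aCoef hU hsmooth hhyp hk).mono hNU
  have hopen := fun k => isOpen_pd_ne_zero (j := k) hU (hsmooth i)
  have hI : ∀ k, k ≠ i → ∀ v ∈ N, pd k (pd i (lam i)) v + aCoef lam i k v * pd i (lam i) v -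
      pd k (lam i) v * bCoef lam i j v = 0 := by
    intro k hk
    refine eq_zero_of_eq_zero_off_interior (f := pd k (lam i)) hNo ?_ ?_ ?_
    · exact ((((contDiffOn_pd hU (hs1 i) k).mono hNU).add
        ((hca k hk).mul ((hs1 i).mono hNU))).sub (((hs1 k).mono hNU).mul hcb)).continuousOn
    · intro v hv hne
      rw [← ((hNsub v hv).2.2.1 k hk hne).1, ← pd_mul_bCoef (hhyp v (hNU hv) k i hk) hne,
        pd_comm hU (hsmooth i) (hNU hv)]
      ring
    · intro v hv hz
      rw [pd_comm hU (hsmooth i) (hNU hv), pd_eq_zero_of_eventually_zero hz, aCoef, hz.self_of_nhds]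
      simp
  have hII : ∀ k, k ≠ i → ∀ v ∈ N,
      pd k (bCoef lam i j) v + aCoef lam i k v * bCoef lam i j v = 0 := by
    intro k hk
    refine eq_zero_of_eq_zero_off_interior (f := pd k (lam i)) hNo ?_ ?_ ?_
    · exact ((contDiffOn_pd hNo hcb k).add ((hca k hk).mul hcb)).continuousOn
    · intro v hv hne
      have hcongr : bCoef lam i j =ᶠ[𝓝 v] bCoef lam i k := by
        filter_upwards [hNo.mem_nhds hv, (hopen k).mem_nhds ⟨hNU hv, hne⟩] with y hy hy'
        exact ((hNsub y hy).2.2.1 k hk hy'.2).1.symm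
      rw [pd_congr hcongr, hcongr.eq_of_nhds]
      exact ((hNsub v hv).2.2.1 k hk hne).2
    · intro v hv hz
      have hkj : k ≠ j := fun e => (hNsub v hv).2.1.1 (e ▸ hz.self_of_nhds)
      rw [pd_bCoef_eq_zero hU hsmooth hhyp (hNU hv) hj (hNsub v hv).2.1.1 hz
        ((hNsub v hv).1 j k hj hk hkj), aCoef, hz.self_of_nhds]
      simp
  filter_upwards [hNo.mem_nhds huN] with v hv
  exact ⟨(hNsub v hv).2.1.1, fun k hk => ⟨sub_eq_zero.1 (hI k hk v hv), hII k hk v hv⟩⟩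

end Coefficients

/-! ### First integrals and Lie brackets. -/

section Bracket

variable {E : Type*} [NormedAddCommGroup E] [NormedSpace ℝ E] {F : E → ℝ} {W : Set E} {q : E}

theorem second_fderiv_apply_of_annihilates (hW : IsOpen W) (hF : ContDiffOn ℝ ∞ F W) (hq : q ∈ W)
    {X : E → E} {X' v : E} (hX : ∀ q ∈ W, fderiv ℝ F q (X q) = 0)
    (hX' : HasLineDerivAt ℝ X X' q v) :
    fderiv ℝ (fderiv ℝ F) q v (X q) + fderiv ℝ F q X' = 0 := by
  have hline : HasDerivAt (fun t : ℝ => q + t • v) v 0 := by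
    simpa using ((hasDerivAt_id (0 : ℝ)).smul_const v).const_add q
  have hd : HasFDerivAt (fderiv ℝ F) (fderiv ℝ (fderiv ℝ F) q) (q + (0 : ℝ) • v) := by
    rw [zero_smul, add_zero]
    exact (((hF.fderiv_of_isOpen hW (m := ∞) (by simp)).differentiableOn
      (by simp)).differentiableAt (hW.mem_nhds hq)).hasFDerivAt
  have h1 := HasDerivAt.clm_apply (c := fun t : ℝ => fderiv ℝ F (q + t • v))
    (hd.comp_hasDerivAt (0 : ℝ) hline) hX'
  rw [zero_smul, add_zero] at h1
  refine h1.unique ((hasDerivAt_const (0 : ℝ) (0 : ℝ)).congr_of_eventuallyEq ?_)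
  have hmem : ∀ᶠ t in 𝓝 (0 : ℝ), q + t • v ∈ W :=
    hline.continuousAt.eventually_mem (hW.mem_nhds (by simpa using hq))
  filter_upwards [hmem] with t ht using hX _ ht

/-- A function annihilated by two vector fields is annihilated by their Lie bracket. -/
theorem fderiv_bracket_eq_zero (hW : IsOpen W) (hF : ContDiffOn ℝ ∞ F W) (hq : q ∈ W)
    {X Y : E → E} {X' Y' : E} (hX : ∀ q ∈ W, fderiv ℝ F q (X q) = 0)
    (hY : ∀ q ∈ W, fderiv ℝ F q (Y q) = 0) (hX' : HasLineDerivAt ℝ X X' q (Y q))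
    (hY' : HasLineDerivAt ℝ Y Y' q (X q)) : fderiv ℝ F q (Y' - X') = 0 := by
  have h1 := second_fderiv_apply_of_annihilates hW hF hq hX hX'
  have h2 := second_fderiv_apply_of_annihilates hW hF hq hY hY'
  have h3 : fderiv ℝ (fderiv ℝ F) q (X q) (Y q) = fderiv ℝ (fderiv ℝ F) q (Y q) (X q) :=
    ((hF.contDiffAt (hW.mem_nhds hq)).isSymmSndFDerivAt
      (by simpa using WithTop.coe_le_coe.2 (le_top : (2 : ℕ∞) ≤ ⊤))) _ _
  rw [map_sub]
  linarith

end Bracket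

/-! ### The distribution and its first brackets. -/

section Jets

variable {n : ℕ}

/-- The coordinate vector `∂/∂x`. -/
def dirX : Jet n := (1, 0, 0, 0)
/-- The coordinate vector `∂/∂t`. -/
def dirT : Jet n := (0, 1, 0, 0)
/-- The coordinate vector `∂/∂u^k`. -/
def dirU (k : Fin n) : Jet n := (0, 0, Pi.single k 1, 0)
/-- The coordinate vector `∂/∂u^k_x`. -/
def dirP (k : Fin n) : Jet n := (0, 0, 0, Pi.single k 1)

theorem apply_eq_sum_dir (L : Jet n →L[ℝ] ℝ) (v : Jet n) :
    L v = v.x * L dirX + v.t * L dirT + ∑ k, v.u k * L (dirU k) + ∑ k, v.ux k * L (dirP k) := by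
  have h : v = v.x • dirX + v.t • dirT + ∑ k, v.u k • dirU k + ∑ k, v.ux k • dirP k := by
    obtain ⟨x, t, u, p⟩ := v
    refine Prod.ext ?_ (Prod.ext ?_ (Prod.ext ?_ ?_))
    · simp [dirX, dirT, dirU, dirP, Prod.fst_sum]
    · simp [dirX, dirT, dirU, dirP, Prod.snd_sum, Prod.fst_sum]
    · ext l
      simp [dirX, dirT, dirU, dirP, Prod.snd_sum, Prod.fst_sum, Finset.sum_apply,
        Pi.single_apply]
    · ext l
      simp [dirX, dirT, dirU, dirP, Prod.snd_sum, Finset.sum_apply, Pi.single_apply]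
  conv_lhs => rw [h]
  simp [map_sum]

/-- The vector field `c + α(u) ∂_x + β(u) (u^i_x)^m ∂_{u^i_x}`. -/
def field (i : Fin n) (c : Jet n) (α β : (Fin n → ℝ) → ℝ) (m : ℕ) (q : Jet n) : Jet n :=
  c + α q.u • dirX + (β q.u * q.ux i ^ m) • dirP i

theorem hasLineDerivAt_field {i : Fin n} (c : Jet n) {α β : (Fin n → ℝ) → ℝ} (m : ℕ) {q : Jet n}
    (hα : DifferentiableAt ℝ α q.u) (hβ : DifferentiableAt ℝ β q.u) (v : Jet n) :
    HasLineDerivAt ℝ (field i c α β m)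
      ((fderiv ℝ α q.u v.u) • dirX + (fderiv ℝ β q.u v.u * q.ux i ^ m +
        β q.u * (m * q.ux i ^ (m - 1) * v.ux i)) • dirP i) q v := by
  have hu : HasDerivAt (fun t : ℝ => q.u + t • v.u) v.u 0 := by
    simpa using ((hasDerivAt_id (0 : ℝ)).smul_const v.u).const_add q.u
  have hp : HasDerivAt (fun t : ℝ => q.ux i + t * v.ux i) (v.ux i) 0 := by
    simpa using ((hasDerivAt_id (0 : ℝ)).mul_const (v.ux i)).const_add (q.ux i)
  have h0 : q.u = q.u + (0 : ℝ) • v.u := by simp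
  have hα' : HasDerivAt (fun t : ℝ => α (q.u + t • v.u)) (fderiv ℝ α q.u v.u) 0 := by
    refine HasFDerivAt.comp_hasDerivAt (0 : ℝ) ?_ hu
    rw [← h0]
    exact hα.hasFDerivAt
  have hβ' : HasDerivAt (fun t : ℝ => β (q.u + t • v.u)) (fderiv ℝ β q.u v.u) 0 := by
    refine HasFDerivAt.comp_hasDerivAt (0 : ℝ) ?_ hu
    rw [← h0]
    exact hβ.hasFDerivAt
  have h1 := ((hα'.smul_const (dirX : Jet n)).const_add c).add
    ((hβ'.mul (hp.pow m)).smul_const (dirP i : Jet n))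
  simp only [zero_smul, add_zero, Pi.pow_apply, zero_mul] at h1
  exact h1

variable {lam : Fin n → (Fin n → ℝ) → ℝ} {i : Fin n} {F : Jet n → ℝ} {W : Set (Jet n)}
  {U : Set (Fin n → ℝ)} {q : Jet n}

theorem dirP_mem_monge {j : Fin n} (hj : j ≠ i) (q : Jet n) : dirP j ∈ monge lam i q := by
  change _ ∧ _ ∧ _ ∧ _
  simp [Jet.x, Jet.t, Jet.u, Jet.ux, dirP, hj.symm]

/-- The field spanning, together with the `∂/∂u^j_x`, `j ≠ i`, the `i`-th Monge distribution. -/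
noncomputable def mongeField (lam : Fin n → (Fin n → ℝ) → ℝ) (i : Fin n) (q : Jet n) : Jet n :=
  (-lam i q.u, 1, fun k => (lam k q.u - lam i q.u) * q.ux k,
    Pi.single i (totalDx (lam i) q * q.ux i))

theorem mongeField_mem_monge (q : Jet n) : mongeField lam i q ∈ monge lam i q := by
  change _ ∧ _ ∧ _ ∧ _
  refine ⟨?_, ?_, fun j _ => ?_, ?_⟩ <;> simp [Jet.x, Jet.t, Jet.u, Jet.ux, mongeField]
  ring

theorem fderiv_dirP_eq_zero (hkill : ∀ q ∈ W, ∀ v ∈ monge lam i q, fderiv ℝ F q v = 0)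
    (hq : q ∈ W) {j : Fin n} (hj : j ≠ i) : fderiv ℝ F q (dirP j) = 0 :=
  hkill q hq _ (dirP_mem_monge hj q)

theorem fderiv_dirU_eq (hW : IsOpen W) (hF : ContDiffOn ℝ ∞ F W)
    (hkill : ∀ q ∈ W, ∀ v ∈ monge lam i q, fderiv ℝ F q v = 0) (hq : q ∈ W) {j : Fin n}
    (hj : j ≠ i) (hne : lam j q.u ≠ lam i q.u) :
    fderiv ℝ F q (dirU j) = -(aCoef lam i j q.u * q.ux i * fderiv ℝ F q (dirP i)) := by
  have hne' : lam j q.u - lam i q.u ≠ 0 := sub_ne_zero.2 hne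
  let Z : Jet n := (lam j q.u - lam i q.u) • dirU j + (pd j (lam i) q.u * q.ux i) • dirP i
  have hZ : HasLineDerivAt ℝ (mongeField lam i) Z q (dirP j) := by
    -- Since `j ≠ i`, the field is affine in `u^j_x`; the slope `Z` is the bracket.
    have haff : ∀ t : ℝ, mongeField lam i (q + t • dirP j) = mongeField lam i q + t • Z := by
      intro t
      have hu : (q + t • (dirP j : Jet n)).u = q.u := by simp [Jet.u, dirP]
      have hp : (q + t • (dirP j : Jet n)).ux = q.ux + t • Pi.single j 1 := by simp [Jet.ux, dirP]
      have hD : totalDx (lam i) (q + t • dirP j) = totalDx (lam i) q + t * pd j (lam i) q.u := by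
        simp only [totalDx, hu, hp]
        simp [add_mul, Finset.sum_add_distrib, Pi.single_apply]
      unfold mongeField
      rw [hu, hp, hD]
      refine Prod.ext ?_ (Prod.ext ?_ (Prod.ext ?_ ?_))
      · simp [Z, dirU, dirP]
      · simp [Z, dirU, dirP]
      · ext l
        by_cases hl : l = j
        · subst hl; simp [Z, dirU, dirP]; ring
        · simp [Z, dirU, dirP, hl]
      · ext l
        by_cases hl : l = i
        · subst hl; simp [Z, dirU, dirP, hj.symm]; ring
        · simp [Z, dirU, dirP, hl]
    have h : HasDerivAt (fun t : ℝ => mongeField lam i q + t • Z) Z 0 := by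
      simpa using ((hasDerivAt_id (0 : ℝ)).smul_const Z).const_add (mongeField lam i q)
    unfold HasLineDerivAt
    simpa only [haff] using h
  have h := fderiv_bracket_eq_zero hW hF hq (X := fun _ => dirP j) (Y := mongeField lam i)
    (X' := 0) (fun q hq => fderiv_dirP_eq_zero hkill hq hj)
    (fun q hq => hkill q hq _ (mongeField_mem_monge q)) (hasDerivAt_const _ _) hZ
  simp only [Z, sub_zero, map_add, map_smul, smul_eq_mul] at h
  rw [aCoef]
  field_simp
  linarith

/-- Eliminating the `∂/∂u^k`, `k ≠ i`, from `mongeField` cancels every term of `D_x λ^i` except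
`u^i_x λ^i_i`. -/
theorem fderiv_dirT_eq (hW : IsOpen W) (hF : ContDiffOn ℝ ∞ F W)
    (hkill : ∀ q ∈ W, ∀ v ∈ monge lam i q, fderiv ℝ F q v = 0) (hq : q ∈ W)
    (hne : ∀ j, j ≠ i → lam j q.u ≠ lam i q.u) :
    fderiv ℝ F q dirT = lam i q.u * fderiv ℝ F q dirX -
      pd i (lam i) q.u * q.ux i ^ 2 * fderiv ℝ F q (dirP i) := by
  have h := hkill q hq _ (mongeField_mem_monge q)
  rw [apply_eq_sum_dir] at h
  have h1 : ∑ k, (mongeField lam i q).u k * fderiv ℝ F q (dirU k) =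
      -(∑ k ∈ Finset.univ.erase i, q.ux k * pd k (lam i) q.u) *
        (q.ux i * fderiv ℝ F q (dirP i)) := by
    rw [← Finset.add_sum_erase _ _ (Finset.mem_univ i), ← Finset.sum_neg_distrib, Finset.sum_mul]
    have : (mongeField lam i q).u i = 0 := by simp [Jet.u, mongeField]
    rw [this, zero_mul, zero_add]
    refine Finset.sum_congr rfl fun k hk => ?_
    have hk' := Finset.ne_of_mem_erase hk
    rw [fderiv_dirU_eq hW hF hkill hq hk' (hne k hk'), aCoef]
    have : lam k q.u - lam i q.u ≠ 0 := sub_ne_zero.2 (hne k hk')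
    simp only [mongeField]
    field_simp
  have h2 : ∑ k, (mongeField lam i q).ux k * fderiv ℝ F q (dirP k) =
      totalDx (lam i) q * q.ux i * fderiv ℝ F q (dirP i) := by
    rw [Finset.sum_eq_single i]
    · simp [Jet.ux, mongeField]
    · intro k _ hk; simp [Jet.ux, mongeField, hk]
    · simp
  rw [h1, h2, totalDx, ← Finset.add_sum_erase _ _ (Finset.mem_univ i)] at h
  simp only [mongeField] at h
  linear_combination h

end Jets

/-! ### Brackets of the reduced fields. -/

section Brackets

variable {n : ℕ} {lam : Fin n → (Fin n → ℝ) → ℝ} {i : Fin n} {F : Jet n → ℝ} {W : Set (Jet n)}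
  {U : Set (Fin n → ℝ)} {q : Jet n}

theorem fderiv_field (c : Jet n) (α β : (Fin n → ℝ) → ℝ) (m : ℕ) (L : Jet n →L[ℝ] ℝ) :
    L (field i c α β m q) = L c + α q.u * L dirX + β q.u * q.ux i ^ m * L (dirP i) := by
  simp [field]

theorem fderiv_bracket_field (hW : IsOpen W) (hF : ContDiffOn ℝ ∞ F W) (hq : q ∈ W)
    {c c' : Jet n} {α β α' β' : (Fin n → ℝ) → ℝ} {m m' : ℕ}
    (hX : ∀ q ∈ W, fderiv ℝ F q (field i c α β m q) = 0)
    (hY : ∀ q ∈ W, fderiv ℝ F q (field i c' α' β' m' q) = 0)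
    (hα : DifferentiableAt ℝ α q.u) (hβ : DifferentiableAt ℝ β q.u)
    (hα' : DifferentiableAt ℝ α' q.u) (hβ' : DifferentiableAt ℝ β' q.u)
    (hc : c.ux = 0) (hc' : c'.ux = 0) :
    (fderiv ℝ α' q.u c.u - fderiv ℝ α q.u c'.u) * fderiv ℝ F q dirX +
      ((fderiv ℝ β' q.u c.u * q.ux i ^ m' +
          β' q.u * (m' * q.ux i ^ (m' - 1) * (β q.u * q.ux i ^ m))) -
        (fderiv ℝ β q.u c'.u * q.ux i ^ m +
          β q.u * (m * q.ux i ^ (m - 1) * (β' q.u * q.ux i ^ m')))) *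
        fderiv ℝ F q (dirP i) = 0 := by
  have hu : ∀ (c : Jet n) (α β : (Fin n → ℝ) → ℝ) (m : ℕ), (field i c α β m q).u = c.u := by
    intro c α β m; simp [Jet.u, field, dirX, dirP]
  have hux : ∀ (c : Jet n) (α β : (Fin n → ℝ) → ℝ) (m : ℕ), c.ux = 0 →
      (field i c α β m q).ux i = β q.u * q.ux i ^ m := by
    intro c α β m h
    have : c.ux i = 0 := by rw [h]; rfl
    simp only [Jet.ux] at this
    simp [Jet.ux, Jet.u, field, dirX, dirP, this]
  have h := fderiv_bracket_eq_zero hW hF hq hX hY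
    (hasLineDerivAt_field c m hα hβ _) (hasLineDerivAt_field c' m' hα' hβ' _)
  simp only [hu, hux _ _ _ _ hc, hux _ _ _ _ hc', map_sub, map_add, map_smul, smul_eq_mul] at h
  linear_combination h

variable (hU : IsOpen U) (hsmooth : ∀ k, ContDiffOn ℝ ∞ (lam k) U)
  (hhyp : ∀ u ∈ U, ∀ j k, j ≠ k → lam j u ≠ lam k u) (hW : IsOpen W)
  (hWU : ∀ q ∈ W, q.u ∈ U) (hF : ContDiffOn ℝ ∞ F W)
  (hkill : ∀ q ∈ W, ∀ v ∈ monge lam i q, fderiv ℝ F q v = 0)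

include hhyp hW hWU hF hkill in
theorem fderiv_fieldU_eq_zero {j : Fin n} (hj : j ≠ i) :
    ∀ q ∈ W, fderiv ℝ F q (field i (dirU j) (fun _ => 0) (aCoef lam i j) 1 q) = 0 := by
  intro q hq
  rw [fderiv_field, fderiv_dirU_eq hW hF hkill hq hj (hhyp _ (hWU q hq) j i hj)]
  ring

include hhyp hW hWU hF hkill in
theorem fderiv_fieldT_eq_zero :
    ∀ q ∈ W, fderiv ℝ F q (field i dirT (fun u => -lam i u) (pd i (lam i)) 2 q) = 0 := by
  intro q hq
  rw [fderiv_field, fderiv_dirT_eq hW hF hkill hq fun j hj => hhyp _ (hWU q hq) j i hj]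
  ring

end Brackets

/-! ### Equations forced on a Riemann invariant. -/

section Consequences

variable {n : ℕ} {lam : Fin n → (Fin n → ℝ) → ℝ} {i : Fin n} {F : Jet n → ℝ} {W : Set (Jet n)}
  {U : Set (Fin n → ℝ)} {q : Jet n} {j k : Fin n}

variable (hU : IsOpen U) (hsmooth : ∀ k, ContDiffOn ℝ ∞ (lam k) U)
  (hhyp : ∀ u ∈ U, ∀ j k, j ≠ k → lam j u ≠ lam k u) (hW : IsOpen W)
  (hWU : ∀ q ∈ W, q.u ∈ U) (hF : ContDiffOn ℝ ∞ F W)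
  (hkill : ∀ q ∈ W, ∀ v ∈ monge lam i q, fderiv ℝ F q v = 0)

include hhyp hW hWU hF hkill in
/-- The differential of a Riemann invariant is determined by its values on `∂/∂x`, `∂/∂u^i` and
`∂/∂u^i_x`. -/
theorem fderiv_apply_eq (hq : q ∈ W) (v : Jet n) :
    fderiv ℝ F q v = (v.x + lam i q.u * v.t) * fderiv ℝ F q dirX + v.u i * fderiv ℝ F q (dirU i) +
      (v.ux i - pd i (lam i) q.u * q.ux i ^ 2 * v.t -
        ∑ k ∈ Finset.univ.erase i, v.u k * (aCoef lam i k q.u * q.ux i)) *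
      fderiv ℝ F q (dirP i) := by
  have h1 : ∑ k, v.u k * fderiv ℝ F q (dirU k) = v.u i * fderiv ℝ F q (dirU i) -
      (∑ k ∈ Finset.univ.erase i, v.u k * (aCoef lam i k q.u * q.ux i)) *
        fderiv ℝ F q (dirP i) := by
    rw [← Finset.add_sum_erase _ _ (Finset.mem_univ i), sub_eq_add_neg, ← neg_mul,
      ← Finset.sum_neg_distrib, Finset.sum_mul]
    congr 1
    refine Finset.sum_congr rfl fun k hk => ?_
    have hk' := Finset.ne_of_mem_erase hk
    rw [fderiv_dirU_eq hW hF hkill hq hk' (hhyp _ (hWU q hq) k i hk')]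
    ring
  have h2 : ∑ k, v.ux k * fderiv ℝ F q (dirP k) = v.ux i * fderiv ℝ F q (dirP i) := by
    refine Finset.sum_eq_single i (fun k _ hk => ?_) (by simp)
    rw [fderiv_dirP_eq_zero hkill hq hk, mul_zero]
  rw [apply_eq_sum_dir, h1, h2,
    fderiv_dirT_eq hW hF hkill hq fun j hj => hhyp _ (hWU q hq) j i hj]
  ring

include hU hsmooth hhyp hW hWU hF hkill

/-- This is the bracket of `∂_{u^j} + a_{ij} p ∂_p` with `∂_t - λ^i ∂_x + λ^i_i p² ∂_p`. -/
theorem pd_lam_mul_fderiv_dirX (hq : q ∈ W) (hj : j ≠ i) :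
    pd j (lam i) q.u * fderiv ℝ F q dirX =
      (pd i (pd j (lam i)) q.u + aCoef lam i j q.u * pd i (lam i) q.u) * q.ux i ^ 2 *
        fderiv ℝ F q (dirP i) := by
  have hqU := hWU q hq
  have hd := differentiableAt_of_contDiffOn hU (hsmooth i) hqU
  have h := fderiv_bracket_field hW hF hq (fderiv_fieldU_eq_zero hhyp hW hWU hF hkill hj)
    (fderiv_fieldT_eq_zero hhyp hW hWU hF hkill) (differentiableAt_const _)
    (differentiableAt_of_contDiffOn hU (contDiffOn_aCoef hU hsmooth hhyp hj) hqU) hd.neg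
    (differentiableAt_of_contDiffOn hU (contDiffOn_pd hU (hsmooth i) i) hqU) rfl rfl
  rw [fderiv_fun_neg] at h
  have e1 : fderiv ℝ (lam i) q.u (dirU j : Jet n).u = pd j (lam i) q.u := rfl
  have e2 : fderiv ℝ (pd i (lam i)) q.u (dirU j : Jet n).u = pd i (pd j (lam i)) q.u :=
    pd_comm hU (hsmooth i) hqU j i
  have e3 : ((dirT : Jet n).u) = 0 := rfl
  simp only [neg_apply, e1, e2, e3, map_zero] at h
  push_cast at h
  norm_num at h
  linear_combination -h

theorem fderiv_dirX_eq (hq : q ∈ W) (hj : j ≠ i) (h0 : pd j (lam i) q.u ≠ 0) :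
    fderiv ℝ F q dirX = bCoef lam i j q.u * q.ux i ^ 2 * fderiv ℝ F q (dirP i) := by
  have h := pd_lam_mul_fderiv_dirX hU hsmooth hhyp hW hWU hF hkill hq hj
  rw [pd_mul_bCoef (hhyp _ (hWU q hq) j i hj) h0] at h
  exact mul_left_cancel₀ h0 (by linear_combination h)

/-- This is the bracket of the reduced fields belonging to `u^j` and `u^k`. -/
theorem semihamiltonian_mul_fderiv_dirP (hq : q ∈ W) (hj : j ≠ i) (hk : k ≠ i) :
    (pd j (aCoef lam i k) q.u - pd k (aCoef lam i j) q.u) * q.ux i *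
      fderiv ℝ F q (dirP i) = 0 := by
  have hqU := hWU q hq
  have hda := fun j (hj : j ≠ i) =>
    differentiableAt_of_contDiffOn hU (contDiffOn_aCoef hU hsmooth hhyp hj) hqU
  have h := fderiv_bracket_field hW hF hq (fderiv_fieldU_eq_zero hhyp hW hWU hF hkill hj)
    (fderiv_fieldU_eq_zero hhyp hW hWU hF hkill hk) (differentiableAt_const _) (hda j hj)
    (differentiableAt_const _) (hda k hk) rfl rfl
  have e : ∀ j k, fderiv ℝ (aCoef lam i k) q.u (dirU j : Jet n).u = pd j (aCoef lam i k) q.u :=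
    fun _ _ => rfl
  simp only [e, fderiv_fun_const, Pi.zero_apply, zero_apply] at h
  norm_num at h
  rcases h with h | h
  · linear_combination fderiv ℝ F q (dirP i) * h
  · rw [h, mul_zero]

/-- This is the bracket of `∂_{u^k} + a_{ik} p ∂_p` with `∂_x - b_{ik} p² ∂_p`, a field available
only where `λ^i_k ≠ 0`; hence the smaller set `W'`. -/
theorem bCoef_equation_mul_fderiv_dirP (hq : q ∈ W) (hk : k ≠ i) (h0 : pd k (lam i) q.u ≠ 0) :
    (pd k (bCoef lam i k) q.u + aCoef lam i k q.u * bCoef lam i k q.u) * q.ux i ^ 2 *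
      fderiv ℝ F q (dirP i) = 0 := by
  have hqU := hWU q hq
  have hopen := isOpen_pd_ne_zero (j := k) hU (hsmooth i)
  have hcu : Continuous fun q : Jet n => q.u := by unfold Jet.u; fun_prop
  let W' : Set (Jet n) := W ∩ (fun q : Jet n => q.u) ⁻¹' {u | u ∈ U ∧ pd k (lam i) u ≠ 0}
  have hW' : IsOpen W' := hW.inter (hopen.preimage hcu)
  have hWW : W' ⊆ W := Set.inter_subset_left
  have hX : ∀ q ∈ W', fderiv ℝ F q
      (field i dirX (fun _ => 0) (fun u => -bCoef lam i k u) 2 q) = 0 := fun q hq => by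
    rw [fderiv_field, fderiv_dirX_eq hU hsmooth hhyp hW hWU hF hkill (hWW hq) hk hq.2.2]
    ring
  have hdb := differentiableAt_of_contDiffOn hopen (contDiffOn_bCoef hU hsmooth hhyp hk)
    (show q.u ∈ _ from ⟨hqU, h0⟩)
  have h := fderiv_bracket_field hW' (hF.mono hWW) (show q ∈ W' from ⟨hq, hqU, h0⟩)
    (fun q hq => fderiv_fieldU_eq_zero hhyp hW hWU hF hkill hk q (hWW hq)) hX
    (differentiableAt_const _)
    (differentiableAt_of_contDiffOn hU (contDiffOn_aCoef hU hsmooth hhyp hk) hqU)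
    (differentiableAt_const _) hdb.neg rfl rfl
  rw [fderiv_fun_neg] at h
  have e1 : fderiv ℝ (bCoef lam i k) q.u (dirU k : Jet n).u = pd k (bCoef lam i k) q.u := rfl
  have e2 : ((dirX : Jet n).u) = 0 := rfl
  simp only [neg_apply, e1, e2, map_zero, fderiv_fun_const, Pi.zero_apply, zero_apply] at h
  norm_num at h
  rcases h with h | h
  · linear_combination -fderiv ℝ F q (dirP i) * h
  · rw [h, mul_zero]

end Consequences

/-! ### Linear independence of differentials. -/

section Independence

variable {n : ℕ} {i : Fin n} {q : Jet n}

theorem fderiv_u_apply (i : Fin n) (q v : Jet n) :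
    fderiv ℝ (fun q : Jet n => q.u i) q v = v.u i := by
  let L : Jet n →L[ℝ] ℝ := (ContinuousLinearMap.proj (R := ℝ) (φ := fun _ : Fin n => ℝ) i).comp
    ((ContinuousLinearMap.fst ℝ _ _).comp ((ContinuousLinearMap.snd ℝ _ _).comp
      (ContinuousLinearMap.snd ℝ _ _)))
  change fderiv ℝ L q v = L v
  rw [L.fderiv]

theorem linearIndependent_of_apply_ne_zero {L : Jet n →L[ℝ] ℝ} {w : Jet n} (hw : w.u i = 0)
    (hL : L w ≠ 0) : LinearIndependent ℝ ![fderiv ℝ (fun q : Jet n => q.u i) q, L] := by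
  rw [LinearIndependent.pair_iff]
  intro s t h
  have ht : t = 0 := by
    have := congrArg (fun M : Jet n →L[ℝ] ℝ => M w) h
    simpa [fderiv_u_apply, hw, hL] using this
  subst ht
  have := congrArg (fun M : Jet n →L[ℝ] ℝ => M (dirU i)) h
  simpa [fderiv_u_apply, dirU, Jet.u] using this

theorem not_linearIndependent_pair {L : Jet n →L[ℝ] ℝ} {e : ℝ} (hL : ∀ v, L v = v.u i * e) :
    ¬ LinearIndependent ℝ ![fderiv ℝ (fun q : Jet n => q.u i) q, L] := by
  rw [LinearIndependent.pair_iff]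
  intro h
  have := h e (-1) (by
    refine ContinuousLinearMap.ext fun v => ?_
    simp [fderiv_u_apply, hL]
    ring)
  norm_num at this

theorem not_linearIndependent_triple {L M : Jet n →L[ℝ] ℝ} {w : Jet n → ℝ} {c c' e e' : ℝ}
    (hL : ∀ v, L v = w v * c + v.u i * e) (hM : ∀ v, M v = w v * c' + v.u i * e') :
    ¬ LinearIndependent ℝ ![fderiv ℝ (fun q : Jet n => q.u i) q, L, M] := by
  intro h
  rw [Fintype.linearIndependent_iff] at h
  -- This relation eliminates `w`. It is trivial only if `c = 0`, in which case `L` is itself a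
  -- multiple of `du^i`.
  have h1 := h ![c * e' - c' * e, c', -c] (by
    refine ContinuousLinearMap.ext fun v => ?_
    simp [Fin.sum_univ_three, fderiv_u_apply, hL, hM]
    ring)
  have hc : c = 0 := by simpa using h1 2
  have h2 := h ![e, -1, 0] (by
    refine ContinuousLinearMap.ext fun v => ?_
    simp [Fin.sum_univ_three, fderiv_u_apply, hL, hc]
    ring) 1
  norm_num at h2

end Independence

/-! ### Necessity of the conditions, and uniqueness. -/

section Localization

variable {n : ℕ} {lam : Fin n → (Fin n → ℝ) → ℝ} {i : Fin n} {F G : Jet n → ℝ}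
  {U : Set (Fin n → ℝ)} {q₀ : Jet n}

theorem continuous_jet_u : Continuous fun q : Jet n => q.u := by unfold Jet.u; fun_prop

theorem continuous_jet_ux (i : Fin n) : Continuous fun q : Jet n => q.ux i := by
  unfold Jet.ux; fun_prop

theorem IsRiemannInvariantAt.exists_isOpen (hF : IsRiemannInvariantAt lam i q₀ F)
    {P : Jet n → Prop} (hP : ∀ᶠ q in 𝓝 q₀, P q) :
    ∃ W, IsOpen W ∧ q₀ ∈ W ∧ (∀ q ∈ W, P q) ∧ ContDiffOn ℝ ∞ F W ∧
      ∀ q ∈ W, ∀ v ∈ monge lam i q, fderiv ℝ F q v = 0 := by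
  obtain ⟨V, hV, hqV, hFV, hkill⟩ := hF
  obtain ⟨W, hW, hWo, hqW⟩ := eventually_nhds_iff.1 hP
  exact ⟨V ∩ W, hV.inter hWo, ⟨hqV, hqW⟩, fun q hq => hW q hq.2,
    hFV.mono Set.inter_subset_left, fun q hq => hkill q hq.1⟩

theorem IsRiemannInvariantAt.eventually_fderiv_apply_ne_zero
    (hF : IsRiemannInvariantAt lam i q₀ F) {v : Jet n} (hv : fderiv ℝ F q₀ v ≠ 0) :
    ∀ᶠ q in 𝓝 q₀, fderiv ℝ F q v ≠ 0 := by
  obtain ⟨V, hV, hqV, hFV, -⟩ := hF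
  have hc : ContinuousOn (fun q => fderiv ℝ F q v) V :=
    ((hFV.fderiv_of_isOpen hV (m := ∞) (by simp)).clm_apply contDiffOn_const).continuousOn
  exact (hc.continuousAt (hV.mem_nhds hqV)).eventually_ne hv

theorem eventually_of_eventually_jet {P : (Fin n → ℝ) → Prop}
    (h : ∀ᶠ q : Jet n in 𝓝 q₀, P q.u) : ∀ᶠ u in 𝓝 q₀.u, P u := by
  have hc : Continuous fun u : Fin n → ℝ => ((q₀.x, q₀.t, u, q₀.ux) : Jet n) := by fun_prop
  exact hc.continuousAt.tendsto.eventually (p := fun q : Jet n => P q.u) h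

/-- The bracket equations carry a factor `u^i_x`, which may vanish at `q₀`. As `P` depends on `u`
only, the base point can be moved slightly in the direction `u^i_x` without changing `u`. -/
theorem eventually_of_eventually_jet_of_ux_ne_zero {P : (Fin n → ℝ) → Prop}
    (h : ∀ᶠ q : Jet n in 𝓝 q₀, q.ux i ≠ 0 → P q.u) : ∀ᶠ u in 𝓝 q₀.u, P u := by
  have hc : Continuous fun s : ℝ =>
      ((q₀.x, q₀.t, q₀.u, q₀.ux + s • Pi.single i 1) : Jet n) := by fun_prop
  have h0 : ((q₀.x, q₀.t, q₀.u, q₀.ux + (0 : ℝ) • Pi.single i 1) : Jet n) = q₀ := by simp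
  have h1 : ∀ᶠ s in 𝓝 (0 : ℝ), ∀ᶠ q : Jet n in
      𝓝 ((q₀.x, q₀.t, q₀.u, q₀.ux + s • Pi.single i 1) : Jet n), q.ux i ≠ 0 → P q.u :=
    hc.continuousAt.tendsto.eventually (by rw [h0]; exact eventually_eventually_nhds.2 h)
  have h2 : ∀ᶠ s in 𝓝[≠] (0 : ℝ), q₀.ux i + s ≠ 0 := by
    by_cases hp : q₀.ux i = 0
    · filter_upwards [self_mem_nhdsWithin] with s hs
      simpa [hp] using hs
    · refine nhdsWithin_le_nhds ?_
      have hc' : Continuous fun s : ℝ => q₀.ux i + s := by fun_prop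
      exact hc'.continuousAt.eventually_ne (by simpa using hp)
  obtain ⟨s, hs1, hs2⟩ := ((h1.filter_mono nhdsWithin_le_nhds).and h2).exists
  have h3 : ∀ᶠ q : Jet n in 𝓝 ((q₀.x, q₀.t, q₀.u, q₀.ux + s • Pi.single i 1) : Jet n),
      q.ux i ≠ 0 :=
    (continuous_jet_ux i).continuousAt.eventually_ne (by simpa [Jet.ux] using hs2)
  refine eventually_of_eventually_jet
    (q₀ := ((q₀.x, q₀.t, q₀.u, q₀.ux + s • Pi.single i 1) : Jet n)) ?_
  filter_upwards [hs1, h3] with q h h' using h h'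

variable (hU : IsOpen U) (hsmooth : ∀ k, ContDiffOn ℝ ∞ (lam k) U)
  (hhyp : ∀ u ∈ U, ∀ j k, j ≠ k → lam j u ≠ lam k u) (hq₀ : q₀.u ∈ U)

include hU hq₀ in
theorem eventually_jet_u_mem : ∀ᶠ q in 𝓝 q₀, Jet.u q ∈ U :=
  continuous_jet_u.continuousAt.eventually_mem (hU.mem_nhds hq₀)

include hU hsmooth hq₀ in
theorem eventually_jet_pd_ne_zero {j : Fin n} (h0 : pd j (lam i) q₀.u ≠ 0) :
    ∀ᶠ q in 𝓝 q₀, pd j (lam i) (Jet.u q) ≠ 0 :=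
  (eventually_jet_u_mem (isOpen_pd_ne_zero hU (hsmooth i)) ⟨hq₀, h0⟩).mono fun _ h => h.2

include hU hhyp hq₀

theorem not_linearIndependent_of_orderZero (hF : IsRiemannInvariantAt lam i q₀ F)
    (hF0 : IsOrderZeroAt q₀ F) (hG : IsRiemannInvariantAt lam i q₀ G) (hG0 : IsOrderZeroAt q₀ G) :
    ∀ᶠ q in 𝓝 q₀, ¬ LinearIndependent ℝ
      ![fderiv ℝ (fun q : Jet n => q.u i) q, fderiv ℝ F q, fderiv ℝ G q] := by
  have hev := eventually_jet_u_mem hU hq₀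
  obtain ⟨W, hW, hqW, hWU, hFW, hFk⟩ := hF.exists_isOpen hev
  obtain ⟨W', hW', hqW', hWU', hGW, hGk⟩ := hG.exists_isOpen hev
  filter_upwards [hW.mem_nhds hqW, hW'.mem_nhds hqW', hF0, hG0] with q hq hq' hF0 hG0
  refine not_linearIndependent_triple (w := fun v => v.x + lam i q.u * v.t)
    (c := fderiv ℝ F q dirX) (c' := fderiv ℝ G q dirX) (e := fderiv ℝ F q (dirU i))
    (e' := fderiv ℝ G q (dirU i)) (fun v => ?_) (fun v => ?_)
  · rw [fderiv_apply_eq hhyp hW hWU hFW hFk hq, show fderiv ℝ F q (dirP i) = 0 from hF0 _]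
    ring
  · rw [fderiv_apply_eq hhyp hW' hWU' hGW hGk hq', show fderiv ℝ G q (dirP i) = 0 from hG0 _]
    ring

include hsmooth

theorem not_linearIndependent_of_pd_ne_zero (hF : IsRiemannInvariantAt lam i q₀ F)
    (hG : IsRiemannInvariantAt lam i q₀ G) {j : Fin n} (hj : j ≠ i)
    (h0 : pd j (lam i) q₀.u ≠ 0) :
    ∀ᶠ q in 𝓝 q₀, ¬ LinearIndependent ℝ
      ![fderiv ℝ (fun q : Jet n => q.u i) q, fderiv ℝ F q, fderiv ℝ G q] := by
  have hev := eventually_jet_u_mem hU hq₀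
  obtain ⟨W, hW, hqW, hWU, hFW, hFk⟩ := hF.exists_isOpen hev
  obtain ⟨W', hW', hqW', hWU', hGW, hGk⟩ := hG.exists_isOpen hev
  filter_upwards [hW.mem_nhds hqW, hW'.mem_nhds hqW',
    eventually_jet_pd_ne_zero hU hsmooth hq₀ h0] with q hq hq' h0
  -- Substituting `F_x = b_{ij} p² F_p` leaves `du^i` and this one form, which depends on neither
  -- `F` nor `G`.
  refine not_linearIndependent_triple (w := fun v => (v.x + lam i q.u * v.t) *
    (bCoef lam i j q.u * q.ux i ^ 2) + (v.ux i - pd i (lam i) q.u * q.ux i ^ 2 * v.t -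
        ∑ k ∈ Finset.univ.erase i, v.u k * (aCoef lam i k q.u * q.ux i)))
    (c := fderiv ℝ F q (dirP i)) (c' := fderiv ℝ G q (dirP i)) (e := fderiv ℝ F q (dirU i))
    (e' := fderiv ℝ G q (dirU i)) (fun v => ?_) (fun v => ?_)
  · rw [fderiv_apply_eq hhyp hW hWU hFW hFk hq,
      fderiv_dirX_eq hU hsmooth hhyp hW hWU hFW hFk hq hj h0]
    ring
  · rw [fderiv_apply_eq hhyp hW' hWU' hGW hGk hq',
      fderiv_dirX_eq hU hsmooth hhyp hW' hWU' hGW hGk hq' hj h0]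
    ring

theorem transverselyConstantAt_of_admitsExtra (h : AdmitsExtra IsOrderZeroAt lam i q₀) :
    TransverselyConstantAt lam i q₀.u := by
  obtain ⟨F, hF, hF0, hind⟩ := h
  obtain ⟨W, hW, hqW, hWP, hFW, hFk⟩ :=
    hF.exists_isOpen ((eventually_jet_u_mem hU hq₀).and hF0)
  have hWU := fun q hq => (hWP q hq).1
  have hFp : ∀ q ∈ W, fderiv ℝ F q (dirP i) = 0 := fun q hq => (hWP q hq).2 _
  -- With `F_p = 0`, vanishing of `F_x` would make `dF` a multiple of `du^i`.
  have hx : fderiv ℝ F q₀ dirX ≠ 0 := by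
    intro hx
    refine not_linearIndependent_pair (e := fderiv ℝ F q₀ (dirU i)) (fun v => ?_) hind
    rw [fderiv_apply_eq hhyp hW hWU hFW hFk hqW, hx, hFp q₀ hqW]
    ring
  refine eventually_of_eventually_jet ?_
  filter_upwards [hW.mem_nhds hqW, hF.eventually_fderiv_apply_ne_zero hx] with q hq hxq k hk
  have h := pd_lam_mul_fderiv_dirX hU hsmooth hhyp hW hWU hFW hFk hq hk
  rw [hFp q hq, mul_zero] at h
  exact (mul_eq_zero.1 h).resolve_right hxq

theorem orderOneConditionsAt_of_admitsExtra (h : AdmitsExtra IsOrderOneAt lam i q₀) {j : Fin n}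
    (hj : j ≠ i) (h0 : pd j (lam i) q₀.u ≠ 0) : OrderOneConditionsAt lam i q₀.u := by
  obtain ⟨F, hF, -, hind⟩ := h
  have hp : fderiv ℝ F q₀ (dirP i) ≠ 0 := by
    intro hp
    obtain ⟨W, hW, hqW, hWU, hFW, hFk⟩ := hF.exists_isOpen (eventually_jet_u_mem hU hq₀)
    refine not_linearIndependent_pair (e := fderiv ℝ F q₀ (dirU i)) (fun v => ?_) hind
    rw [fderiv_apply_eq hhyp hW hWU hFW hFk hqW,
      fderiv_dirX_eq hU hsmooth hhyp hW hWU hFW hFk hqW hj h0, hp]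
    ring
  obtain ⟨W, hW, hqW, hWP, hFW, hFk⟩ := hF.exists_isOpen ((eventually_jet_u_mem hU hq₀).and
    ((hF.eventually_fderiv_apply_ne_zero hp).and (eventually_jet_pd_ne_zero hU hsmooth hq₀ h0)))
  have hWU := fun q hq => (hWP q hq).1
  have hb : ∀ q ∈ W, q.ux i ≠ 0 → ∀ k, k ≠ i → pd k (lam i) q.u ≠ 0 →
      pd k (bCoef lam i k) q.u + aCoef lam i k q.u * bCoef lam i k q.u = 0 := by
    intro q hq hpq k hk hk0
    have h := bCoef_equation_mul_fderiv_dirP hU hsmooth hhyp hW hWU hFW hFk hq hk hk0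
    exact (mul_eq_zero.1 ((mul_eq_zero.1 h).resolve_right (hWP q hq).2.1)).resolve_right
      (pow_ne_zero 2 hpq)
  refine ⟨?_, j, hj, ?_, ?_⟩
  · refine eventually_of_eventually_jet_of_ux_ne_zero (i := i) ?_
    filter_upwards [hW.mem_nhds hqW] with q hq hpq j k hj hk _
    have h := semihamiltonian_mul_fderiv_dirP hU hsmooth hhyp hW hWU hFW hFk hq hj hk
    exact sub_eq_zero.1
      ((mul_eq_zero.1 ((mul_eq_zero.1 h).resolve_right (hWP q hq).2.1)).resolve_right hpq)
  · refine eventually_of_eventually_jet_of_ux_ne_zero (i := i) ?_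
    filter_upwards [hW.mem_nhds hqW] with q hq hpq
    exact ⟨(hWP q hq).2.2, hb q hq hpq j hj (hWP q hq).2.2⟩
  · refine eventually_of_eventually_jet_of_ux_ne_zero (i := i) ?_
    filter_upwards [hW.mem_nhds hqW] with q hq hpq k hk hk0
    refine ⟨?_, hb q hq hpq k hk hk0⟩
    have h1 := fderiv_dirX_eq hU hsmooth hhyp hW hWU hFW hFk hq hk hk0
    rw [fderiv_dirX_eq hU hsmooth hhyp hW hWU hFW hFk hq hj (hWP q hq).2.2, mul_assoc,
      mul_assoc] at h1
    exact (mul_right_cancel₀ (mul_ne_zero (pow_ne_zero 2 hpq) (hWP q hq).2.1) h1).symm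

end Localization

/-! ### Construction of the invariants. -/

section Construction

variable {n : ℕ} {lam : Fin n → (Fin n → ℝ) → ℝ} {i : Fin n} {q₀ q : Jet n}
  {U : Set (Fin n → ℝ)}

theorem hasDerivAt_comp_jet_u {f : (Fin n → ℝ) → ℝ} {q : Jet n} (hf : DifferentiableAt ℝ f q.u)
    (v : Jet n) :
    HasDerivAt (fun t : ℝ => f (q.u + t • v.u)) (fderiv ℝ f q.u v.u) 0 := by
  have hu : HasDerivAt (fun t : ℝ => q.u + t • v.u) v.u 0 := by
    simpa using ((hasDerivAt_id (0 : ℝ)).smul_const v.u).const_add q.u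
  refine HasFDerivAt.comp_hasDerivAt (0 : ℝ) ?_ hu
  rw [zero_smul, add_zero]
  exact hf.hasFDerivAt

theorem hasDerivAt_add_mul (a b : ℝ) : HasDerivAt (fun t : ℝ => a + t * b) b 0 := by
  simpa using ((hasDerivAt_id (0 : ℝ)).mul_const b).const_add a

theorem fderiv_apply_eq_of_hasLineDerivAt {F : Jet n → ℝ} {v : Jet n} {d : ℝ}
    (hF : DifferentiableAt ℝ F q) (h : HasLineDerivAt ℝ F d q v) : fderiv ℝ F q v = d :=
  (hF.hasFDerivAt.hasLineDerivAt v).unique h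

theorem fderiv_apply_eq_sum_erase_mul {f g : (Fin n → ℝ) → ℝ} {c : Fin n → ℝ} {v : Jet n}
    (hv : v.u i = 0) (h : ∀ k, k ≠ i → pd k f q.u = c k * g q.u) :
    fderiv ℝ f q.u v.u = (∑ k ∈ Finset.univ.erase i, v.u k * c k) * g q.u := by
  rw [fderiv_apply_eq_sum_pd, ← Finset.add_sum_erase _ _ (Finset.mem_univ i), hv, zero_mul,
    zero_add, Finset.sum_mul]
  refine Finset.sum_congr rfl fun k hk => ?_
  rw [h k (Finset.ne_of_mem_erase hk), mul_assoc]

/-- The order-zero invariant `x + λ^i t` of a transversely constant `λ^i`. -/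
theorem TransverselyConstantAt.isExtraRiemannInvariantAt (hU : IsOpen U)
    (hsmooth : ∀ k, ContDiffOn ℝ ∞ (lam k) U) (hq₀ : q₀.u ∈ U)
    (h : TransverselyConstantAt lam i q₀.u) :
    IsExtraRiemannInvariantAt IsOrderZeroAt lam i q₀ fun q => q.x + lam i q.u * q.t := by
  obtain ⟨N, hN, hNo, huN⟩ := eventually_nhds_iff.1 (h.and (hU.mem_nhds hq₀))
  have hcu : ContDiff ℝ ∞ fun q : Jet n => q.u := by unfold Jet.u; fun_prop
  have hcx : ContDiff ℝ ∞ fun q : Jet n => q.x := by unfold Jet.x; fun_prop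
  have hct : ContDiff ℝ ∞ fun q : Jet n => q.t := by unfold Jet.t; fun_prop
  have hVo : IsOpen ((fun q : Jet n => q.u) ⁻¹' N) := hNo.preimage continuous_jet_u
  have hcont : ContDiffOn ℝ ∞ (fun q : Jet n => q.x + lam i q.u * q.t)
      ((fun q : Jet n => q.u) ⁻¹' N) :=
    hcx.contDiffOn.add ((((hsmooth i).mono fun u hu => (hN u hu).2).comp hcu.contDiffOn
      fun q hq => hq).mul hct.contDiffOn)
  have hfd : ∀ q : Jet n, q.u ∈ N → ∀ v,
      fderiv ℝ (fun q : Jet n => q.x + lam i q.u * q.t) q v =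
        v.x + (fderiv ℝ (lam i) q.u v.u * q.t + lam i q.u * v.t) := by
    intro q hq v
    refine fderiv_apply_eq_of_hasLineDerivAt
      ((hcont.differentiableOn (by simp)).differentiableAt (hVo.mem_nhds hq)) ?_
    have h1 := (hasDerivAt_add_mul q.x v.x).add ((hasDerivAt_comp_jet_u
      (differentiableAt_of_contDiffOn hU (hsmooth i) (hN _ hq).2) v).mul
      (hasDerivAt_add_mul q.t v.t))
    simp only [zero_smul, add_zero, zero_mul] at h1
    exact h1
  refine ⟨⟨_, hVo, huN, hcont, ?_⟩, ?_, ?_⟩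
  · rintro q hq v ⟨hv1, hv2, -, -⟩
    rw [hfd q hq, fderiv_apply_eq_sum_erase_mul (c := 0) (g := 0) hv2
      fun k hk => by simpa using (hN _ hq).1 k hk]
    simp only [Pi.zero_apply]
    linear_combination hv1
  · filter_upwards [hVo.mem_nhds huN] with q hq w
    rw [hfd q hq]
    simp [Jet.x, Jet.t, Jet.u]
  · refine linearIndependent_of_apply_ne_zero (w := dirX) rfl ?_
    rw [hfd q₀ huN]
    simp [dirX, Jet.x, Jet.t, Jet.u]

/-- `e^{-φ} p / (1 - p (b (x - x₀) + c (t - t₀)))`, with `p = u^i_x`. -/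
noncomputable def orderOneInvariant (i : Fin n) (q₀ : Jet n) (φ b c : (Fin n → ℝ) → ℝ)
    (q : Jet n) : ℝ :=
  Real.exp (-φ q.u) * (q.ux i / (1 - q.ux i * (b q.u * (q.x - q₀.x) + c q.u * (q.t - q₀.t))))

variable {φ b c : (Fin n → ℝ) → ℝ}

theorem contDiffOn_orderOneInvariant (hφ : ContDiff ℝ ∞ φ) (hb : ContDiff ℝ ∞ b)
    (hc : ContDiff ℝ ∞ c) :
    ContDiffOn ℝ ∞ (orderOneInvariant i q₀ φ b c)
      {q : Jet n | 1 - q.ux i * (b q.u * (q.x - q₀.x) + c q.u * (q.t - q₀.t)) ≠ 0} ∧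
    IsOpen {q : Jet n | 1 - q.ux i * (b q.u * (q.x - q₀.x) + c q.u * (q.t - q₀.t)) ≠ 0} := by
  have hcu : ContDiff ℝ ∞ fun q : Jet n => q.u := by unfold Jet.u; fun_prop
  have hcx : ContDiff ℝ ∞ fun q : Jet n => q.x := by unfold Jet.x; fun_prop
  have hct : ContDiff ℝ ∞ fun q : Jet n => q.t := by unfold Jet.t; fun_prop
  have hcp : ContDiff ℝ ∞ fun q : Jet n => q.ux i := by unfold Jet.ux; fun_prop
  have hden : ContDiff ℝ ∞ fun q : Jet n =>
      1 - q.ux i * (b q.u * (q.x - q₀.x) + c q.u * (q.t - q₀.t)) :=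
    contDiff_const.sub (hcp.mul (((hb.comp hcu).mul (hcx.sub contDiff_const)).add
      ((hc.comp hcu).mul (hct.sub contDiff_const))))
  exact ⟨(hφ.comp hcu).neg.exp.contDiffOn.mul (hcp.contDiffOn.div hden.contDiffOn fun q hq => hq),
    isOpen_ne_fun hden.continuous continuous_const⟩

theorem hasLineDerivAt_orderOneInvariant (hφ : DifferentiableAt ℝ φ q.u)
    (hb : DifferentiableAt ℝ b q.u) (hc : DifferentiableAt ℝ c q.u)
    (h0 : 1 - q.ux i * (b q.u * (q.x - q₀.x) + c q.u * (q.t - q₀.t)) ≠ 0) (v : Jet n) :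
    HasLineDerivAt ℝ (orderOneInvariant i q₀ φ b c)
      (Real.exp (-φ q.u) / (1 - q.ux i * (b q.u * (q.x - q₀.x) + c q.u * (q.t - q₀.t))) ^ 2 *
        (v.ux i + q.ux i ^ 2 * (fderiv ℝ b q.u v.u * (q.x - q₀.x) + b q.u * v.x +
            (fderiv ℝ c q.u v.u * (q.t - q₀.t) + c q.u * v.t)) -
          fderiv ℝ φ q.u v.u * q.ux i *
            (1 - q.ux i * (b q.u * (q.x - q₀.x) + c q.u * (q.t - q₀.t))))) q v := by
  have hp := hasDerivAt_add_mul (q.ux i) (v.ux i)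
  have hx := (hasDerivAt_add_mul q.x v.x).sub_const q₀.x
  have ht := (hasDerivAt_add_mul q.t v.t).sub_const q₀.t
  have hB := ((hasDerivAt_comp_jet_u hb v).mul hx).add ((hasDerivAt_comp_jet_u hc v).mul ht)
  have hden := (hp.mul hB).const_sub 1
  have hF := (hasDerivAt_comp_jet_u hφ v).neg.exp.mul (hp.div hden (by simpa using h0))
  refine HasDerivAt.congr_deriv hF ?_
  simp only [Pi.add_apply, Pi.mul_apply, Pi.neg_apply, Pi.div_apply, zero_smul, add_zero, zero_mul]
  field_simp
  ring

/-- The conditions on `φ`, `b`, `c` say that `e^φ b` and `e^φ c` do not depend on `u^k`, `k ≠ i`,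
and that the change of `1/p` in time is balanced by `b` and `c`. At `q₀` the denominator is `1`, so
the derivative in `u^i_x` is `e^{-φ} ≠ 0`, which gives both independence and order one. -/
theorem isExtraRiemannInvariantAt_orderOneInvariant (hφ : ContDiff ℝ ∞ φ) (hb : ContDiff ℝ ∞ b)
    (hc : ContDiff ℝ ∞ c) (hhyp : ∀ᶠ u in 𝓝 q₀.u, ∀ k, k ≠ i → lam k u ≠ lam i u)
    (hcb : ∀ᶠ u in 𝓝 q₀.u, c u = lam i u * b u - pd i (lam i) u)
    (hpd : ∀ᶠ u in 𝓝 q₀.u, ∀ k, k ≠ i → pd k φ u = aCoef lam i k u ∧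
      pd k b u = -aCoef lam i k u * b u ∧ pd k c u = -aCoef lam i k u * c u) :
    IsExtraRiemannInvariantAt IsOrderOneAt lam i q₀ (orderOneInvariant i q₀ φ b c) := by
  obtain ⟨N, hN, hNo, huN⟩ := eventually_nhds_iff.1 (hhyp.and (hcb.and hpd))
  obtain ⟨hcont, hopen⟩ := contDiffOn_orderOneInvariant (i := i) (q₀ := q₀) hφ hb hc
  have hfd : ∀ q : Jet n, 1 - q.ux i * (b q.u * (q.x - q₀.x) + c q.u * (q.t - q₀.t)) ≠ 0 → ∀ v, _ :=
    fun q hq v => fderiv_apply_eq_of_hasLineDerivAt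
      ((hcont.differentiableOn (by simp)).differentiableAt (hopen.mem_nhds hq))
      (hasLineDerivAt_orderOneInvariant (hφ.differentiable (by simp) _)
        (hb.differentiable (by simp) _) (hc.differentiable (by simp) _) hq v)
  have hne : fderiv ℝ (orderOneInvariant i q₀ φ b c) q₀ (dirP i) ≠ 0 := by
    rw [hfd q₀ (by simp)]
    simp [dirP, Jet.x, Jet.t, Jet.u, Jet.ux]
  have hVo : IsOpen ((fun q : Jet n => q.u) ⁻¹' N) := hNo.preimage continuous_jet_u
  refine ⟨⟨_, hopen.inter hVo, ⟨by simp, huN⟩, hcont.mono Set.inter_subset_left, ?_⟩, ?_,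
    linearIndependent_of_apply_ne_zero rfl hne⟩
  · rintro q ⟨hq0, hqN⟩ v ⟨hv1, hv2, hv3, hv4⟩
    obtain ⟨hlam, hcq, hq⟩ := hN _ hqN
    let S := ∑ k ∈ Finset.univ.erase i, v.u k * aCoef lam i k q.u
    have hSφ : fderiv ℝ φ q.u v.u = S := by
      rw [fderiv_apply_eq_sum_erase_mul (c := fun k => aCoef lam i k q.u) (g := 1) hv2
        fun k hk => by simpa using (hq k hk).1]
      simp [S]
    have hneg : ∑ k ∈ Finset.univ.erase i, v.u k * -aCoef lam i k q.u = -S := by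
      simp [S]
    have hSb : fderiv ℝ b q.u v.u = -S * b q.u := by
      rw [fderiv_apply_eq_sum_erase_mul hv2 fun k hk => (hq k hk).2.1, hneg]
    have hSc : fderiv ℝ c q.u v.u = -S * c q.u := by
      rw [fderiv_apply_eq_sum_erase_mul hv2 fun k hk => (hq k hk).2.2, hneg]
    have hS : S = (totalDx (lam i) q - q.ux i * pd i (lam i) q.u) * v.t := by
      rw [totalDx, ← Finset.add_sum_erase _ _ (Finset.mem_univ i), add_sub_cancel_left,
        Finset.sum_mul]
      refine Finset.sum_congr rfl fun k hk => ?_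
      have hk' := Finset.ne_of_mem_erase hk
      have hne : lam k q.u - lam i q.u ≠ 0 := sub_ne_zero.2 (hlam k hk')
      rw [show v.u k = (lam k q.u - lam i q.u) * q.ux k * v.t by linear_combination hv3 k hk',
        aCoef]
      field_simp
    rw [hfd q hq0, hSφ, hSb, hSc]
    refine mul_eq_zero_of_right _ ?_
    rw [show v.ux i = totalDx (lam i) q * q.ux i * v.t by linear_combination hv4,
      show v.x = -lam i q.u * v.t by linear_combination hv1]
    linear_combination (-q.ux i) * hS + q.ux i ^ 2 * v.t * hcq
  · intro h0
    exact hne (h0.self_of_nhds _)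

theorem OrderOneConditionsAt.admitsExtra (hU : IsOpen U)
    (hsmooth : ∀ k, ContDiffOn ℝ ∞ (lam k) U)
    (hhyp : ∀ u ∈ U, ∀ j k, j ≠ k → lam j u ≠ lam k u) (hq₀ : q₀.u ∈ U)
    (h : OrderOneConditionsAt lam i q₀.u) : AdmitsExtra IsOrderOneAt lam i q₀ := by
  obtain ⟨j, hj, hev⟩ := h.exists_bCoef hU hsmooth hhyp hq₀
  obtain ⟨φ, hφ, hφa⟩ := exists_potential hU
    (fun k hk => contDiffOn_aCoef hU hsmooth hhyp hk) hq₀ h.1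
  have hopen := isOpen_pd_ne_zero (j := j) hU (hsmooth i)
  have hmem : q₀.u ∈ {u | u ∈ U ∧ pd j (lam i) u ≠ 0} := ⟨hq₀, hev.self_of_nhds.1⟩
  have hbs := contDiffOn_bCoef hU hsmooth hhyp hj
  have hsub : {u | u ∈ U ∧ pd j (lam i) u ≠ 0} ⊆ U := fun u hu => hu.1
  have hs1 := contDiffOn_pd hU (hsmooth i) i
  obtain ⟨b, hb, hbe⟩ := exists_contDiff_eventuallyEq hopen hbs hmem
  obtain ⟨c, hc, hce⟩ := exists_contDiff_eventuallyEq hopen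
    ((((hsmooth i).mono hsub).mul hbs).sub (hs1.mono hsub)) hmem
  refine ⟨_, isExtraRiemannInvariantAt_orderOneInvariant hφ hb hc ?_ ?_ ?_⟩
  · filter_upwards [hU.mem_nhds hq₀] with u hu k hk using hhyp u hu k i hk
  · filter_upwards [hbe, hce] with u hb hc
    rw [hb, hc]
  · filter_upwards [hev, hφa, hbe.eventuallyEq_nhds, hce.eventuallyEq_nhds, hopen.mem_nhds hmem]
      with u hu hφu hbu hcu huU k hk
    have hdb := differentiableAt_of_contDiffOn hopen hbs huU
    have hdl := differentiableAt_of_contDiffOn hU (hsmooth i) huU.1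
    have hds := differentiableAt_of_contDiffOn hU hs1 huU.1
    obtain ⟨h1, h2⟩ := hu.2 k hk
    refine ⟨hφu k hk, ?_, ?_⟩
    · rw [pd_congr hbu, hbu.eq_of_nhds]
      linear_combination h2
    · rw [pd_congr hcu, hcu.eq_of_nhds]
      have h3 := pd_sub (hdl.mul hdb) hds k
      have h4 := pd_mul hdl hdb k
      change pd k (fun v => (lam i * bCoef lam i j) v - pd i (lam i) v) u = _
      rw [h3]
      change pd k (fun v => lam i v * bCoef lam i j v) u - _ =
        -aCoef lam i k u * (lam i u * bCoef lam i j u - pd i (lam i) u)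
      rw [h4]
      -- The identity `h1` is what makes `c = λ^i b - λ^i_i` scale like `b`: `∂_k c = -a_{ik} c`.
      linear_combination -h1 + lam i u * h2

end Construction

end Hydro

/-! ### The theorem. -/

theorem lemma1 {n : ℕ} (U : Set (Fin n → ℝ)) (hU : IsOpen U)
    (lam : Fin n → (Fin n → ℝ) → ℝ)
    (hsmooth : ∀ k, ContDiffOn ℝ ∞ (lam k) U)
    (hhyp : ∀ u ∈ U, ∀ j k, j ≠ k → lam j u ≠ lam k u)
    (i : Fin n) :
    -- a) near every point over `U`
    (∀ q₀ : Hydro.Jet n, q₀.u ∈ U →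
      [Hydro.AdmitsExtra Hydro.IsOrderZeroAt lam i q₀,
       Hydro.AdmitsExactlyOneExtra Hydro.IsOrderZeroAt lam i q₀,
       Hydro.TransverselyConstantAt lam i q₀.u].TFAE) ∧
    -- b) near every regular point over `U`
    (∀ q₀ : Hydro.Jet n, q₀.u ∈ U → Hydro.IsRegularPoint lam i q₀.u →
      [Hydro.AdmitsExtra Hydro.IsOrderOneAt lam i q₀ ∧
         ¬ Hydro.AdmitsExtra Hydro.IsOrderZeroAt lam i q₀,
       Hydro.AdmitsExactlyOneExtra Hydro.IsOrderOneAt lam i q₀ ∧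
         ¬ Hydro.AdmitsExtra Hydro.IsOrderZeroAt lam i q₀,
       Hydro.OrderOneConditionsAt lam i q₀.u].TFAE) ∧
    -- the two expressions for `b_{ij}` agree
    (∀ u ∈ U, ∀ j, j ≠ i → Hydro.pd j (lam i) u ≠ 0 →
      Hydro.bCoef lam i j u =
        Hydro.pd i (Hydro.aCoef lam i j) u / Hydro.aCoef lam i j u - Hydro.aCoef lam j i u) := by
  refine ⟨fun q₀ hq₀ => ?_, fun q₀ hq₀ hreg => ?_, fun u hu j hj h0 =>
    Hydro.bCoef_eq_pd_aCoef hU hsmooth hhyp hu hj h0⟩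
  · tfae_have 1 → 3 := Hydro.transverselyConstantAt_of_admitsExtra hU hsmooth hhyp hq₀
    tfae_have 2 → 1 := fun ⟨F, hF, _⟩ => ⟨F, hF⟩
    tfae_have 3 → 2 := fun h => by
      have hF := h.isExtraRiemannInvariantAt hU hsmooth hq₀
      exact ⟨_, hF, fun G hG => Hydro.not_linearIndependent_of_orderZero hU hhyp hq₀
        hF.1 hF.2.1 hG.1 hG.2.1⟩
    tfae_finish
  · tfae_have 1 → 3 := fun ⟨h1, h0⟩ => by
      -- Regularity leaves two cases; in the transversely constant one, `x + λ^i t` is an extra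
      -- invariant of order 0, which is excluded.
      rcases hreg with ⟨j, hj, hne⟩ | hT
      · exact Hydro.orderOneConditionsAt_of_admitsExtra hU hsmooth hhyp hq₀ h1 hj hne
      · exact absurd ⟨_, hT.isExtraRiemannInvariantAt hU hsmooth hq₀⟩ h0
    tfae_have 2 → 1 := fun ⟨⟨F, hF, _⟩, h0⟩ => ⟨⟨F, hF⟩, h0⟩
    tfae_have 3 → 2 := fun h => by
      obtain ⟨F, hF⟩ := h.admitsExtra hU hsmooth hhyp hq₀
      obtain ⟨-, j, hj, hev, -⟩ := h
      have hne := hev.self_of_nhds.1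
      exact ⟨⟨F, hF, fun G hG => Hydro.not_linearIndependent_of_pd_ne_zero hU hsmooth hhyp hq₀
        hF.1 hG.1 hj hne⟩, fun h0 => hne
          ((Hydro.transverselyConstantAt_of_admitsExtra hU hsmooth hhyp hq₀ h0).self_of_nhds j hj)⟩
    tfae_finish
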